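/- There exist absolute constants $C, c > 0$ for which the following holds. Let $(\Omega,\mu)$ be a probability space, let $\|Y\|_{\psi_2}=\inf\{u>0:\mathbb{E}\exp(Y^2/u^2)\le 2\}$, and let $F$ be a subset of the unit sphere $\{f:\|f\|_{L_2(\mu)}=1\}$ of $L_2(\mu)$ with $\alpha := 2\sup_{f\in F}\|f\|_{\psi_2}<\infty$ (if $F$ is symmetric, i.e. $F=-F$, this is the diameter of $F$ in the $\psi_2$ norm). Let $$\gamma_2=\gamma_2(F,\|\cdot\|_{\psi_2})=\inf\,\sup_{f\in F}\sum_{s=0}^\infty 2^{s/2}\inf_{g\in F_s}\|f-g\|_{\psi_2},$$ where the infimum is over all sequences $(F_s)_{s\ge0}$ of nonempty subsets of $F$ with $|F_0|=1$ and $|F_s|\le 2^{2^s}$ for $s\ge1$. Let $k\ge1$, let $X_1,\dots,X_k$ be independent random variables distributed according to $\mu$, and put $Z_f=\frac1k\sum_{i=1}^k f^2(X_i)-\mathbb{E}f^2$. Suprema of $|Z_f|$ over the (possibly uncountable) class $F$ are understood as essential (lattice) suprema; that is, the bounds below are asserted with $\sup_{f\in F}$ replaced by $\sup_{f\in G}$,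 for every countable $G\subseteq F$ (with $\alpha$ and $\gamma_2$ those of $F$). (1) If $F$ is symmetric or, more generally, if $\alpha\le 2\gamma_2$, then with probability at least $1-\exp(-c\,\gamma_2^2/\alpha^3)$, $$\sup_{f\in F}|Z_f|\le C\,\alpha\,\max\Bigl(\frac{\gamma_2}{\sqrt k},\frac{\gamma_2^2}{k}\Bigr).$$ (2) If $F$ is symmetric, then $$\mathbb{E}\sup_{f\in F}|Z_f|\le C\,\alpha\,\max\Bigl(\frac{\gamma_2}{\sqrt k},\frac{\gamma_2^2}{k}\Bigr).$$ -/

import Mathlib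

open MeasureTheory ProbabilityTheory
open scoped ENNReal NNReal

/-- The `ψ₂` norm `inf {u > 0 : 𝔼 exp (Y² / u²) ≤ 2}` of a real random variable `Y`, with values
in `[0, ∞]` (it is `∞` if there is no such `u`). -/
noncomputable def psiTwoNorm {Ω : Type*} [MeasurableSpace Ω] (μ : Measure Ω) (Y : Ω → ℝ) : ℝ≥0∞ :=
  ⨅ (u : ℝ) (_ : 0 < u) (_ : ∫⁻ x, ENNReal.ofReal (Real.exp (Y x ^ 2 / u ^ 2)) ∂μ ≤ 2),
    ENNReal.ofReal u

/-- The distance on `L₂(μ)` given by the `ψ₂` norm. -/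
noncomputable def psiTwoDist {Ω : Type*} [MeasurableSpace Ω] (μ : Measure Ω)
    (f g : Lp ℝ 2 μ) : ℝ≥0∞ :=
  psiTwoNorm μ (f - g : Lp ℝ 2 μ)

/-- The `ψ₂` diameter of a class of functions, `2 sup_{f ∈ F} ‖f‖_{ψ₂}`. For a symmetric class it
is the diameter with respect to the `ψ₂` distance. -/
noncomputable def psiTwoDiam {Ω : Type*} [MeasurableSpace Ω] (μ : Measure Ω)
    (F : Set (Lp ℝ 2 μ)) : ℝ≥0∞ :=
  2 * ⨆ f ∈ F, psiTwoNorm μ f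

/-- Admissible sequences of subsets of `T`: `|T₀| = 1` and `|T_s| ≤ 2 ^ (2 ^ s)` for `s ≥ 1`.
(For infinite `T`, asking for equality of cardinalities gives the same `γ₂`; for finite `T` the
inequality is the usual meaning.) -/
structure IsAdmissible {E : Type*} (T : Set E) (A : ℕ → Set E) : Prop where
  subset : ∀ s, A s ⊆ T
  nonempty : ∀ s, (A s).Nonempty
  card_zero : (A 0).encard = 1
  card_le : ∀ s, 1 ≤ s → (A s).encard ≤ ((2 ^ 2 ^ s : ℕ) : ℕ∞)

/-- The functional `γ₂(T, d) = inf sup_{t ∈ T} ∑_s 2^{s/2} d(t, T_s)`, the infimum being over all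
admissible sequences of `T`. -/
noncomputable def gammaTwo {E : Type*} (d : E → E → ℝ≥0∞) (T : Set E) : ℝ≥0∞ :=
  ⨅ (A : ℕ → Set E) (_ : IsAdmissible T A),
    ⨆ t ∈ T, ∑' s : ℕ, (2 : ℝ≥0∞) ^ ((s : ℝ) / 2) * ⨅ a ∈ A s, d t a

/-- The empirical process `Z_f = k⁻¹ ∑_{i ≤ k} f²(X_i) - 𝔼 f²`. -/
noncomputable def empiricalZ {Ω Ω' : Type*} [MeasurableSpace Ω] (μ : Measure Ω) {k : ℕ}
    (X : Fin k → Ω' → Ω) (f : Lp ℝ 2 μ) (ω : Ω') : ℝ :=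
  (1 / (k : ℝ)) * ∑ i, (f (X i ω)) ^ 2 - ∫ x, (f x) ^ 2 ∂μ

/-- `sup_{f ∈ G} |Z_f|`, with values in `[0, ∞]`. -/
noncomputable def supAbsZ {Ω Ω' : Type*} [MeasurableSpace Ω] (μ : Measure Ω) {k : ℕ}
    (X : Fin k → Ω' → Ω) (G : Set (Lp ℝ 2 μ)) (ω : Ω') : ℝ≥0∞ :=
  ⨆ f ∈ G, ENNReal.ofReal |empiricalZ μ X f ω|

/-- The quantity `α max (γ₂ / √k, γ₂² / k)` with `α` and `γ₂` taken for the class `F`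
and the `ψ₂` norm. -/
noncomputable def chainingBound {Ω : Type*} [MeasurableSpace Ω] (μ : Measure Ω) (k : ℕ)
    (F : Set (Lp ℝ 2 μ)) : ℝ≥0∞ :=
  psiTwoDiam μ F * max (gammaTwo (psiTwoDist μ) F / (k : ℝ≥0∞) ^ (1 / 2 : ℝ))
    (gammaTwo (psiTwoDist μ) F ^ 2 / (k : ℝ≥0∞))

/-! Generic chaining that changes its process at the scale `2 ^ s ≈ k`. Since `f² - g² = (f - g)(f +
g)`, the `ψ₁` norm of an increment is at most `α ‖f - g‖_{ψ₂}`, and Bernstein's inequality controls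
the increments of `Z` at confidence `exp(-u 2 ^ s)`. As long as `2 ^ s ≤ k` the deviation is of
order `2 ^ (s/2) / √k`, which sums along a chain to `α γ₂ / √k`.

Beyond that scale Bernstein becomes linear in `2 ^ s` and chaining with `γ₂` would fail. There one
follows the vectors `v(f) = (f(X_i))_i` in Euclidean space: once `2 ^ s ≳ k`, a Chernoff bound gives
`‖v(f) - v(g)‖ ≲ 2 ^ (s/2) ‖f - g‖_{ψ₂}`. As `F` lies on the sphere, `‖v(f)‖² = k (1 + Z_f)`, so
this bound on `v` returns to one on `Z` at a cost of order `γ₂ / √k + γ₂² / k`.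

Chains start at a level `m` with `2 ^ m ≈ 4 γ₂² / α²`, the largest for which the initial Bernstein
term stays below the target; this produces the exponent in the probability. Such an `m` exists
because `α ≤ 2 γ₂`, which symmetry implies. The deterministic step is `abs_le_of_chain`, the union
bound is `measure_exists_lt_abs_empiricalZ_le`, and `measure_lt_supAbsZ_le` gives tails at every
scale `u`, from which the expectation bound follows. -/

section PsiTwoNorm

/-! ### Calculus of the `ψ₂` norm. -/

variable {Ω : Type*} [MeasurableSpace Ω] {μ : Measure Ω}

lemma lintegral_exp_sq_div_le_two_of_psiTwoNorm_lt {Y : Ω → ℝ} {u : ℝ}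
    (h : psiTwoNorm μ Y < ENNReal.ofReal u) :
    ∫⁻ x, ENNReal.ofReal (Real.exp (Y x ^ 2 / u ^ 2)) ∂μ ≤ 2 := by
  simp only [psiTwoNorm, iInf_lt_iff] at h
  obtain ⟨v, hv, hle, hvu⟩ := h
  have hvu' : v < u := (ENNReal.ofReal_lt_ofReal_iff_of_nonneg hv.le).1 hvu
  refine le_trans (lintegral_mono fun x => ?_) hle
  gcongr

lemma psiTwoNorm_le_ofReal {Y : Ω → ℝ} {u : ℝ} (hu : 0 < u)
    (h : ∫⁻ x, ENNReal.ofReal (Real.exp (Y x ^ 2 / u ^ 2)) ∂μ ≤ 2) :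
    psiTwoNorm μ Y ≤ ENNReal.ofReal u :=
  iInf_le_of_le u (iInf_le_of_le hu (iInf_le _ h))

lemma psiTwoNorm_congr_sq_ae {Y Z : Ω → ℝ} (h : ∀ᵐ x ∂μ, Y x ^ 2 = Z x ^ 2) :
    psiTwoNorm μ Y = psiTwoNorm μ Z := by
  have (u : ℝ) : ∫⁻ x, ENNReal.ofReal (Real.exp (Y x ^ 2 / u ^ 2)) ∂μ =
      ∫⁻ x, ENNReal.ofReal (Real.exp (Z x ^ 2 / u ^ 2)) ∂μ :=
    lintegral_congr_ae (h.mono fun x hx => by simp only [hx])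
  simp only [psiTwoNorm, this]

lemma lintegral_le_two_of_le_convex_comb {f g h : Ω → ℝ} {a b : ℝ} (ha : 0 ≤ a) (hb : 0 ≤ b)
    (hab : a + b = 1) (hf : Measurable f) (hfgh : ∀ x, h x ≤ a * f x + b * g x)
    (hf2 : ∫⁻ x, ENNReal.ofReal (Real.exp (f x)) ∂μ ≤ 2)
    (hg2 : ∫⁻ x, ENNReal.ofReal (Real.exp (g x)) ∂μ ≤ 2) :
    ∫⁻ x, ENNReal.ofReal (Real.exp (h x)) ∂μ ≤ 2 := by
  calc ∫⁻ x, ENNReal.ofReal (Real.exp (h x)) ∂μ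
      ≤ ∫⁻ x, (ENNReal.ofReal a * ENNReal.ofReal (Real.exp (f x)) +
          ENNReal.ofReal b * ENNReal.ofReal (Real.exp (g x))) ∂μ := by
        refine lintegral_mono fun x => ?_
        rw [← ENNReal.ofReal_mul ha, ← ENNReal.ofReal_mul hb,
          ← ENNReal.ofReal_add (by positivity) (by positivity)]
        refine ENNReal.ofReal_le_ofReal ((Real.exp_le_exp.2 (hfgh x)).trans ?_)
        exact convexOn_exp.2 (Set.mem_univ _) (Set.mem_univ _) ha hb hab
    _ = ENNReal.ofReal a * ∫⁻ x, ENNReal.ofReal (Real.exp (f x)) ∂μ +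
          ENNReal.ofReal b * ∫⁻ x, ENNReal.ofReal (Real.exp (g x)) ∂μ := by
        rw [lintegral_add_left (by fun_prop), lintegral_const_mul' _ _ ENNReal.ofReal_ne_top,
          lintegral_const_mul' _ _ ENNReal.ofReal_ne_top]
    _ ≤ ENNReal.ofReal a * 2 + ENNReal.ofReal b * 2 := by gcongr
    _ = 2 := by rw [← add_mul, ← ENNReal.ofReal_add ha hb, hab]; simp

lemma psiTwoNorm_add_le {Y Z : Ω → ℝ} (hY : Measurable Y) :
    psiTwoNorm μ (Y + Z) ≤ psiTwoNorm μ Y + psiTwoNorm μ Z := by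
  refine le_of_forall_gt fun c hc => ?_
  obtain ⟨a, b, ha, hb, hab⟩ : ∃ a b : ℝ≥0, psiTwoNorm μ Y < a ∧ psiTwoNorm μ Z < b ∧
      ((a + b : ℝ≥0) : ℝ≥0∞) < c := by
    have hY' : psiTwoNorm μ Y ≠ ∞ := fun h => by simp [h] at hc
    have hZ' : psiTwoNorm μ Z ≠ ∞ := fun h => by simp [h] at hc
    lift psiTwoNorm μ Y to ℝ≥0 using hY' with y
    lift psiTwoNorm μ Z to ℝ≥0 using hZ' with z
    obtain ⟨e, he, hec⟩ := ENNReal.lt_iff_exists_nnreal_btwn.1 hc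
    have he' : y + z < e := by exact_mod_cast he
    refine ⟨y + (e - (y + z)) / 2, z + (e - (y + z)) / 2, ?_, ?_, ?_⟩
    · exact_mod_cast lt_add_of_pos_right _ (by simpa using he')
    · exact_mod_cast lt_add_of_pos_right _ (by simpa using he')
    · convert hec using 2
      rw [add_add_add_comm, add_halves, add_tsub_cancel_of_le he'.le]
  have ha0 : (0 : ℝ) < a := by exact_mod_cast pos_of_gt ha
  have hb0 : (0 : ℝ) < b := by exact_mod_cast pos_of_gt hb
  rw [← ENNReal.ofReal_coe_nnreal] at ha hb hab
  refine lt_of_le_of_lt (psiTwoNorm_le_ofReal (by push_cast; positivity) ?_) hab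
  have key := lintegral_exp_sq_div_le_two_of_psiTwoNorm_lt ha
  have key' := lintegral_exp_sq_div_le_two_of_psiTwoNorm_lt hb
  -- With these weights `(Y + Z) / (a + b)` is a convex combination of `Y / a` and `Z / b`, and
  -- squaring is convex.
  refine lintegral_le_two_of_le_convex_comb (a := a / (a + b)) (b := b / (a + b))
    (by positivity) (by positivity) (by field_simp) (by fun_prop) (fun x => ?_) key key'
  simp only [Pi.add_apply, NNReal.coe_add]
  rw [← sub_nonneg]
  have : (a : ℝ) / (a + b) * (Y x ^ 2 / a ^ 2) + b / (a + b) * (Z x ^ 2 / b ^ 2) -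
      (Y x + Z x) ^ 2 / (a + b) ^ 2 = (Y x * b - Z x * a) ^ 2 / (a * b * (a + b) ^ 2) := by
    field_simp; ring
  rw [this]; positivity

/-- By the arithmetic-geometric mean inequality and convexity of `exp`, a product of two `ψ₂`
variables is `ψ₁`. It serves for `(f - g)(f + g)`. -/
lemma lintegral_exp_mul_div_le_two {Y Z : Ω → ℝ} (hY : Measurable Y) {a b : ℝ}
    (hY2 : ∫⁻ x, ENNReal.ofReal (Real.exp (Y x ^ 2 / a ^ 2)) ∂μ ≤ 2)
    (hZ2 : ∫⁻ x, ENNReal.ofReal (Real.exp (Z x ^ 2 / b ^ 2)) ∂μ ≤ 2) :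
    ∫⁻ x, ENNReal.ofReal (Real.exp (|Y x * Z x| / (a * b))) ∂μ ≤ 2 := by
  refine lintegral_le_two_of_le_convex_comb (a := 1 / 2) (b := 1 / 2)
    (by positivity) (by positivity) (by norm_num) (by fun_prop) (fun x => ?_) hY2 hZ2
  have h := sq_nonneg (|Y x| / a - |Z x| / b)
  have h1 : |Y x * Z x| / (a * b) = (|Y x| / a) * (|Z x| / b) := by
    rw [abs_mul, div_mul_div_comm]
  have h2 : Y x ^ 2 / a ^ 2 = (|Y x| / a) ^ 2 := by rw [div_pow, sq_abs]
  have h3 : Z x ^ 2 / b ^ 2 = (|Z x| / b) ^ 2 := by rw [div_pow, sq_abs]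
  rw [h1, h2, h3]
  nlinarith

/-- Integrating `1 + x ≤ exp x` at `x = Y² / u²` gives `1 + u⁻² ≤ 2`. This is the source of `α ≥ 2`.
-/
lemma one_le_psiTwoNorm [IsProbabilityMeasure μ] {Y : Ω → ℝ}
    (h : ∫⁻ x, ENNReal.ofReal (Y x ^ 2) ∂μ = 1) : 1 ≤ psiTwoNorm μ Y := by
  refine le_iInf fun u => le_iInf fun hu => le_iInf fun hle => ?_
  have h1 : (1 : ℝ≥0∞) + ENNReal.ofReal (u ^ 2)⁻¹ ≤ 1 + 1 := by
    calc (1 : ℝ≥0∞) + ENNReal.ofReal (u ^ 2)⁻¹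
        = ∫⁻ x, (1 + ENNReal.ofReal (u ^ 2)⁻¹ * ENNReal.ofReal (Y x ^ 2)) ∂μ := by
          rw [lintegral_add_left measurable_const,
            lintegral_const_mul' _ _ ENNReal.ofReal_ne_top, h]
          simp
      _ ≤ ∫⁻ x, ENNReal.ofReal (Real.exp (Y x ^ 2 / u ^ 2)) ∂μ := by
          refine lintegral_mono fun x => ?_
          rw [← ENNReal.ofReal_mul (by positivity), ← ENNReal.ofReal_one,
            ← ENNReal.ofReal_add (by norm_num) (by positivity)]
          refine ENNReal.ofReal_le_ofReal ?_
          have := Real.add_one_le_exp (Y x ^ 2 / u ^ 2)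
          rw [div_eq_inv_mul] at this ⊢
          linarith
      _ ≤ 1 + 1 := by rw [one_add_one_eq_two]; exact hle
  have h2 := (ENNReal.add_le_add_iff_left ENNReal.one_ne_top).1 h1
  rw [ENNReal.ofReal_le_one] at h2
  rw [ENNReal.one_le_ofReal]
  by_contra! hlt
  have : 1 < (u ^ 2)⁻¹ := (one_lt_inv₀ (by positivity)).2 (by nlinarith)
  linarith

end PsiTwoNorm

/-! ### Bernstein and Chernoff bounds for sums over the sample. -/

section Bernstein

variable {Ω : Type*} [MeasurableSpace Ω] {μ : Measure Ω}

lemma integrable_exp_of_lintegral_le_two {Y : Ω → ℝ} (hY : Measurable Y)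
    (h : ∫⁻ x, ENNReal.ofReal (Real.exp (Y x)) ∂μ ≤ 2) :
    Integrable (fun x => Real.exp (Y x)) μ := by
  refine ⟨by fun_prop, ?_⟩
  rw [hasFiniteIntegral_iff_ofReal (ae_of_all _ fun x => (Real.exp_pos _).le)]
  exact h.trans_lt (by simp)

lemma integral_exp_le_two {Y : Ω → ℝ} (hY : Measurable Y)
    (h : ∫⁻ x, ENNReal.ofReal (Real.exp (Y x)) ∂μ ≤ 2) :
    ∫ x, Real.exp (Y x) ∂μ ≤ 2 := by
  rw [integral_eq_lintegral_of_nonneg_ae (ae_of_all _ fun x => (Real.exp_pos _).le) (by fun_prop)]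
  exact ENNReal.toReal_mono (by simp) h

lemma integrable_of_lintegral_exp_abs_le_two {Y : Ω → ℝ} (hY : Measurable Y) {K : ℝ} (hK : 0 < K)
    (h : ∫⁻ x, ENNReal.ofReal (Real.exp (|Y x| / K)) ∂μ ≤ 2) : Integrable Y μ := by
  refine ((integrable_exp_of_lintegral_le_two (by fun_prop) h).const_mul K).mono' (by fun_prop)
    (ae_of_all _ fun x => ?_)
  have := Real.add_one_le_exp (|Y x| / K)
  have h2 : |Y x| = K * (|Y x| / K) := by field_simp
  rw [Real.norm_eq_abs]
  calc |Y x| = K * (|Y x| / K) := h2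
    _ ≤ _ := mul_le_mul_of_nonneg_left (by linarith) hK.le

/-- Start from `exp y ≤ 1 + y + y² exp |y|` at `y = l Y`. As `|l| ≤ 1 / (2K)`, one factor `exp(|Y| /
(2K))` absorbs `y²` and another absorbs `exp |y|`. -/
lemma mgf_le_of_lintegral_exp_abs_le_two [IsProbabilityMeasure μ] {Y : Ω → ℝ} (hY : Measurable Y) {K l : ℝ} (hK : 0 < K)
    (h : ∫⁻ x, ENNReal.ofReal (Real.exp (|Y x| / K)) ∂μ ≤ 2) (hl : |l| ≤ 1 / (2 * K)) :
    Integrable (fun x => Real.exp (l * Y x)) μ ∧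
      mgf Y μ l ≤ Real.exp (l * ∫ x, Y x ∂μ + 16 * l ^ 2 * K ^ 2) := by
  have hint := integrable_exp_of_lintegral_le_two (by fun_prop) h
  have hlY (x : Ω) : |l * Y x| ≤ |Y x| / (2 * K) := by
    rw [abs_mul]
    calc |l| * |Y x| ≤ 1 / (2 * K) * |Y x| := by gcongr
      _ = _ := by ring
  have hi : Integrable (fun x => Real.exp (l * Y x)) μ := by
    refine hint.mono' (by fun_prop) (ae_of_all _ fun x => ?_)
    rw [Real.norm_eq_abs, abs_of_pos (Real.exp_pos _), Real.exp_le_exp]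
    refine (le_abs_self _).trans ((hlY x).trans ?_)
    gcongr
    linarith
  refine ⟨hi, ?_⟩
  have hpt (x : Ω) : Real.exp (l * Y x) ≤
      1 + l * Y x + 8 * l ^ 2 * K ^ 2 * Real.exp (|Y x| / K) := by
    have h1 := Complex.norm_exp_sub_sum_le_norm_mul_exp ((l * Y x : ℝ) : ℂ) 2
    have h2 : Real.exp (l * Y x) - (1 + l * Y x) ≤ (l * Y x) ^ 2 * Real.exp |l * Y x| := by
      have h3 : (Complex.exp ((l * Y x : ℝ) : ℂ) -
          ∑ m ∈ Finset.range 2, ((l * Y x : ℝ) : ℂ) ^ m / (m.factorial : ℂ)) =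
          ((Real.exp (l * Y x) - (1 + l * Y x) : ℝ) : ℂ) := by
        simp [Finset.sum_range_succ]
      rw [h3, Complex.norm_real, Complex.norm_real, Real.norm_eq_abs, Real.norm_eq_abs,
        sq_abs] at h1
      exact (le_abs_self _).trans h1
    have h4 : Real.exp |l * Y x| ≤ Real.exp (|Y x| / (2 * K)) := Real.exp_le_exp.2 (hlY x)
    have h5 : (|Y x| / (2 * K)) ^ 2 / 2 ≤ Real.exp (|Y x| / (2 * K)) := by
      have := Real.quadratic_le_exp_of_nonneg (x := |Y x| / (2 * K)) (by positivity)
      have : 0 ≤ |Y x| / (2 * K) := by positivity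
      linarith
    have h6 : Real.exp (|Y x| / K) = Real.exp (|Y x| / (2 * K)) * Real.exp (|Y x| / (2 * K)) := by
      rw [← Real.exp_add]; congr 1; field_simp; ring
    have h7 : (l * Y x) ^ 2 = 8 * l ^ 2 * K ^ 2 * ((|Y x| / (2 * K)) ^ 2 / 2) := by
      rw [div_pow, sq_abs]; field_simp; ring
    have h8 : (l * Y x) ^ 2 * Real.exp |l * Y x| ≤
        8 * l ^ 2 * K ^ 2 * Real.exp (|Y x| / (2 * K)) * Real.exp (|Y x| / (2 * K)) := by
      rw [h7]; gcongr
    rw [h6]; linarith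
  have hYi := integrable_of_lintegral_exp_abs_le_two hY hK h
  have hE := integral_exp_le_two (by fun_prop) h
  calc mgf Y μ l ≤ ∫ x, (1 + l * Y x + 8 * l ^ 2 * K ^ 2 * Real.exp (|Y x| / K)) ∂μ :=
        integral_mono hi (((integrable_const 1).add (hYi.const_mul l)).add (hint.const_mul _)) hpt
    _ = 1 + l * ∫ x, Y x ∂μ + 8 * l ^ 2 * K ^ 2 * ∫ x, Real.exp (|Y x| / K) ∂μ := by
        rw [integral_add (f := fun x => 1 + l * Y x)
            ((integrable_const 1).add (hYi.const_mul l)) (hint.const_mul _),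
          integral_add (integrable_const 1) (hYi.const_mul l), integral_const_mul,
          integral_const_mul]
        simp
    _ ≤ 1 + l * ∫ x, Y x ∂μ + 8 * l ^ 2 * K ^ 2 * 2 := by gcongr
    _ = (l * ∫ x, Y x ∂μ + 16 * l ^ 2 * K ^ 2) + 1 := by ring
    _ ≤ _ := Real.add_one_le_exp _

variable {Ω' : Type*} [MeasurableSpace Ω'] {P : Measure Ω'} [IsProbabilityMeasure P]
  {k : ℕ} {X : Fin k → Ω' → Ω}

/-- Chernoff's bound for the sum of a function of an independent sample. -/
lemma measure_le_sum_comp_le_exp_mul_mgf_pow (hX : ∀ i, Measurable (X i)) (hind : iIndepFun X P)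
    (hlaw : ∀ i, P.map (X i) = μ) {Y : Ω → ℝ} (hY : Measurable Y) {l : ℝ} (hl : 0 ≤ l)
    (hint : Integrable (fun x => Real.exp (l * Y x)) μ) (x : ℝ) :
    P.real {ω | x ≤ ∑ i, Y (X i ω)} ≤ Real.exp (-l * x) * mgf Y μ l ^ k := by
  have hind' : iIndepFun (fun i => Y ∘ X i) P := hind.comp (fun _ => Y) fun _ => hY
  have hm (i : Fin k) : Measurable (Y ∘ X i) := hY.comp (hX i)
  have hmgf (i : Fin k) : mgf (Y ∘ X i) P l = mgf Y μ l := by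
    rw [← mgf_map (hX i).aemeasurable (by fun_prop), hlaw i]
  have hi (i : Fin k) : Integrable (fun ω => Real.exp (l * (Y ∘ X i) ω)) P := by
    rw [← hlaw i] at hint
    exact hint.comp_measurable (hX i)
  have h := measure_ge_le_exp_mul_mgf (μ := P) (X := ∑ i, Y ∘ X i) x hl
    (hind'.integrable_exp_mul_sum hm fun i _ => hi i)
  rw [hind'.mgf_sum hm] at h
  simpa [hmgf] using h

/-- The one-sided Bernstein inequality for random variables with bounded `ψ₁` norm. -/
lemma measure_mean_add_le_sum_le [IsProbabilityMeasure μ] (hX : ∀ i, Measurable (X i)) (hind : iIndepFun X P)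
    (hlaw : ∀ i, P.map (X i) = μ) (hk : 1 ≤ k) {Y : Ω → ℝ} (hY : Measurable Y) {K r : ℝ}
    (hK : 0 < K) (hr : 0 ≤ r) (h : ∫⁻ x, ENNReal.ofReal (Real.exp (|Y x| / K)) ∂μ ≤ 2) :
    P.real {ω | k * (∫ x, Y x ∂μ) + k * K * (10 * max (√r) r) ≤ ∑ i, Y (X i ω)} ≤
      Real.exp (-(k * r)) := by
  -- The cap at `1` keeps `l` in the admissible range. Since `min 1 √r * max √r r = r`, the exponent
  -- is at most `k (4r - 5r)` in both regimes.
  set l : ℝ := min 1 (√r) / (2 * K) with hl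
  have hl0 : 0 ≤ l := by positivity
  have hl1 : |l| ≤ 1 / (2 * K) := by
    rw [abs_of_nonneg hl0, hl]; gcongr; exact min_le_left _ _
  obtain ⟨hint, hmgf⟩ := mgf_le_of_lintegral_exp_abs_le_two hY hK h hl1
  refine (measure_le_sum_comp_le_exp_mul_mgf_pow hX hind hlaw hY hl0 hint _).trans ?_
  calc _ ≤ Real.exp (-l * (k * (∫ x, Y x ∂μ) + k * K * (10 * max (√r) r))) *
        Real.exp (l * ∫ x, Y x ∂μ + 16 * l ^ 2 * K ^ 2) ^ k := by
        gcongr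
        exact mgf_nonneg
    _ = Real.exp (-l * (k * K * (10 * max (√r) r)) + k * (16 * l ^ 2 * K ^ 2)) := by
        rw [← Real.exp_nat_mul, ← Real.exp_add]; congr 1; ring
    _ ≤ _ := by
        rw [Real.exp_le_exp]
        have h1 : min 1 (√r) * max (√r) r = r := by
          rcases le_total r 1 with h | h
          · have : √r ≤ 1 := Real.sqrt_le_one.2 h
            have h3 : r ≤ √r := Real.le_sqrt_of_sq_le (by nlinarith)
            rw [min_eq_right this, max_eq_left h3, Real.mul_self_sqrt hr]
          · have : 1 ≤ √r := Real.one_le_sqrt.2 h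
            have h3 : √r ≤ r := by nlinarith [Real.mul_self_sqrt hr]
            rw [min_eq_left this, max_eq_right h3, one_mul]
        have h2 : (min 1 (√r)) ^ 2 ≤ r := by
          calc (min 1 (√r)) ^ 2 ≤ (√r) ^ 2 := by gcongr; exact min_le_right _ _
            _ = r := Real.sq_sqrt hr
        have h3 : -l * (k * K * (10 * max (√r) r)) + k * (16 * l ^ 2 * K ^ 2) =
            k * (4 * (min 1 (√r)) ^ 2 - 5 * (min 1 (√r) * max (√r) r)) := by
          rw [hl]; field_simp; ring
        rw [h3, h1, ← mul_neg]
        gcongr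
        linarith

/-- Bernstein's inequality for random variables with bounded `ψ₁` norm. -/
lemma measure_lt_abs_sum_sub_mean_le [IsProbabilityMeasure μ] (hX : ∀ i, Measurable (X i)) (hind : iIndepFun X P)
    (hlaw : ∀ i, P.map (X i) = μ) (hk : 1 ≤ k) {Y : Ω → ℝ} (hY : Measurable Y) {K r : ℝ}
    (hK : 0 < K) (hr : 0 ≤ r) (h : ∫⁻ x, ENNReal.ofReal (Real.exp (|Y x| / K)) ∂μ ≤ 2) :
    P {ω | (10 * max (√r) r) * K < |(1 / (k : ℝ)) * ∑ i, Y (X i ω) - ∫ x, Y x ∂μ|} ≤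
      ENNReal.ofReal (2 * Real.exp (-(k * r))) := by
  have hk0 : (0 : ℝ) < k := by exact_mod_cast hk
  have h1 := measure_mean_add_le_sum_le hX hind hlaw hk hY hK hr h
  have h2 := measure_mean_add_le_sum_le hX hind hlaw hk hY.neg hK hr (by simpa using h)
  rw [← ofReal_measureReal]
  refine ENNReal.ofReal_le_ofReal ?_
  rw [two_mul]
  refine le_trans ?_ (add_le_add h1 h2)
  refine le_trans (measureReal_mono ?_) (measureReal_union_le _ _)
  intro ω hω
  simp only [Set.mem_ofPred_eq, lt_abs] at hω
  have e : ∑ i, Y (X i ω) = k * ((1 / (k : ℝ)) * ∑ i, Y (X i ω)) := by field_simp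
  simp only [Set.mem_union, Set.mem_ofPred_eq, Pi.neg_apply, Finset.sum_neg_distrib, integral_neg]
  rw [e]
  generalize (1 / (k : ℝ)) * ∑ i, Y (X i ω) = A at *
  rcases hω with h | h
  · left
    have := mul_le_mul_of_nonneg_left h.le hk0.le
    linarith
  · right
    have := mul_le_mul_of_nonneg_left h.le hk0.le
    linarith

/-- Chernoff at `l = 1`, with `𝔼 exp(Y² / a²) ≤ 2 ≤ e`. The loss `exp k` is harmless once `t`
exceeds a multiple of `k`. -/
lemma measure_lt_sum_sq_le (hX : ∀ i, Measurable (X i)) (hind : iIndepFun X P)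
    (hlaw : ∀ i, P.map (X i) = μ) {Y : Ω → ℝ} (hY : Measurable Y) {a t : ℝ} (ha : 0 < a)
    (h : ∫⁻ x, ENNReal.ofReal (Real.exp (Y x ^ 2 / a ^ 2)) ∂μ ≤ 2) :
    P {ω | t * a ^ 2 < ∑ i, Y (X i ω) ^ 2} ≤ ENNReal.ofReal (Real.exp (k - t)) := by
  have h1 := measure_le_sum_comp_le_exp_mul_mgf_pow (μ := μ) hX hind hlaw
    (Y := fun x => Y x ^ 2 / a ^ 2) (by fun_prop) (l := 1) zero_le_one
    (by simpa using integrable_exp_of_lintegral_le_two (by fun_prop) h) t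
  have h2 : mgf (fun x => Y x ^ 2 / a ^ 2) μ 1 ≤ Real.exp 1 := by
    refine le_trans ?_ ((integral_exp_le_two (by fun_prop) h).trans ?_)
    · simp [mgf]
    · have := Real.add_one_le_exp 1
      linarith
  rw [← ofReal_measureReal]
  refine ENNReal.ofReal_le_ofReal ((measureReal_mono ?_).trans (h1.trans ?_))
  · intro ω hω
    simp only [Set.mem_ofPred_eq] at hω ⊢
    rw [← Finset.sum_div, le_div_iff₀ (by positivity)]
    exact hω.le
  · calc _ ≤ Real.exp (-1 * t) * Real.exp 1 ^ k := by gcongr; exact mgf_nonneg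
      _ = _ := by rw [← Real.exp_nat_mul, ← Real.exp_add]; congr 1; ring

end Bernstein

/-- A tail bound at every level `x > a` is a tail bound at the level `a`. -/
lemma measure_lt_le_of_forall_gt {α : Type*} [MeasurableSpace α] {P : Measure α} {Y g : _}
    {p : ℝ≥0∞} (a : ℝ) (hg : Continuous (g : ℝ → ℝ))
    (hmono : MonotoneOn g (Set.Ici a)) (h : ∀ x > a, P {ω | g x < (Y : α → ℝ) ω} ≤ p) :
    P {ω | g a < Y ω} ≤ p := by
  have hs : {ω | g a < Y ω} = ⋃ n : ℕ, {ω | g (a + 1 / ((n : ℝ) + 1)) < Y ω} := by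
    ext ω
    simp only [Set.mem_ofPred_eq, Set.mem_iUnion]
    constructor
    · intro hω
      have ht : Filter.Tendsto (fun n : ℕ => g (a + 1 / ((n : ℝ) + 1))) Filter.atTop
          (nhds (g (a + 0))) :=
        (hg.tendsto _).comp (tendsto_const_nhds.add tendsto_one_div_add_atTop_nhds_zero_nat)
      rw [add_zero] at ht
      exact (ht.eventually_lt_const hω).exists
    · rintro ⟨n, hn⟩
      refine lt_of_le_of_lt (hmono (Set.mem_Ici.2 le_rfl) (Set.mem_Ici.2 ?_) ?_) hn
      all_goals
        have : 0 ≤ 1 / ((n : ℝ) + 1) := by positivity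
        linarith
  rw [hs, Monotone.measure_iUnion]
  · refine iSup_le fun n => h _ ?_
    have : 0 < 1 / ((n : ℝ) + 1) := by positivity
    linarith
  · intro m n hmn ω hω
    refine lt_of_le_of_lt (hmono (Set.mem_Ici.2 ?_) (Set.mem_Ici.2 ?_) ?_) hω
    · have : 0 ≤ 1 / ((n : ℝ) + 1) := by positivity
      linarith
    · have : 0 ≤ 1 / ((m : ℝ) + 1) := by positivity
      linarith
    · gcongr

/-! ### Tail bounds for `Z` and its increments. -/

section Tails

variable {Ω Ω' : Type*} [MeasurableSpace Ω] {μ : Measure Ω} {_ : MeasurableSpace Ω'}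
  {P : Measure Ω'} [IsProbabilityMeasure P] {k : ℕ} {X : Fin k → Ω' → Ω}

lemma measurable_coeFn_Lp (f : Lp ℝ 2 μ) : Measurable f := (Lp.stronglyMeasurable f).measurable

lemma psiTwoDist_eq (f g : Lp ℝ 2 μ) : psiTwoDist μ f g = psiTwoNorm μ (⇑f - ⇑g) :=
  psiTwoNorm_congr_sq_ae ((Lp.coeFn_sub f g).mono fun x hx => by rw [hx])

lemma psiTwoNorm_neg (f : Ω → ℝ) : psiTwoNorm μ (-f) = psiTwoNorm μ f :=
  psiTwoNorm_congr_sq_ae (ae_of_all _ fun x => by simp)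

lemma psiTwoDist_comm (f g : Lp ℝ 2 μ) : psiTwoDist μ f g = psiTwoDist μ g f := by
  rw [psiTwoDist_eq, psiTwoDist_eq, ← psiTwoNorm_neg, neg_sub]

lemma psiTwoDist_triangle (f g h : Lp ℝ 2 μ) :
    psiTwoDist μ f h ≤ psiTwoDist μ f g + psiTwoDist μ g h := by
  have hf := measurable_coeFn_Lp f
  have hg := measurable_coeFn_Lp g
  simp only [psiTwoDist_eq]
  rw [← sub_add_sub_cancel (⇑f) (⇑g) (⇑h)]
  exact psiTwoNorm_add_le (hf.sub hg)

lemma psiTwoDist_le_add (f g : Lp ℝ 2 μ) :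
    psiTwoDist μ f g ≤ psiTwoNorm μ f + psiTwoNorm μ g := by
  rw [psiTwoDist_eq, sub_eq_add_neg, ← psiTwoNorm_neg (⇑g)]
  exact psiTwoNorm_add_le (measurable_coeFn_Lp f)

lemma measure_lt_abs_empiricalZ_le [IsProbabilityMeasure μ] (hX : ∀ i, Measurable (X i))
    (hind : iIndepFun X P) (hlaw : ∀ i, P.map (X i) = μ) (hk : 1 ≤ k) (f : Lp ℝ 2 μ) {a r : ℝ}
    (ha : 0 < a) (hr : 0 ≤ r) (h : psiTwoNorm μ f < ENNReal.ofReal a) :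
    P {ω | (10 * max (√r) r) * a ^ 2 < |empiricalZ μ X f ω|} ≤
      ENNReal.ofReal (2 * Real.exp (-(k * r))) := by
  have hf := measurable_coeFn_Lp f
  refine measure_lt_abs_sum_sub_mean_le hX hind hlaw hk (Y := fun x => f x ^ 2) (by fun_prop)
    (by positivity) hr ?_
  simpa using lintegral_exp_sq_div_le_two_of_psiTwoNorm_lt h

lemma empiricalZ_sub {Ω' : Type*} {X : Fin k → Ω' → Ω} (f g : Lp ℝ 2 μ) (ω : Ω') :
    empiricalZ μ X f ω - empiricalZ μ X g ω =
      (1 / (k : ℝ)) * ∑ i, ((f (X i ω)) ^ 2 - (g (X i ω)) ^ 2) -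
        ∫ x, ((f x) ^ 2 - (g x) ^ 2) ∂μ := by
  rw [integral_sub (Lp.memLp f).integrable_sq (Lp.memLp g).integrable_sq,
    Finset.sum_sub_distrib]
  simp only [empiricalZ]
  ring

lemma measure_lt_abs_empiricalZ_sub_le [IsProbabilityMeasure μ] (hX : ∀ i, Measurable (X i))
    (hind : iIndepFun X P) (hlaw : ∀ i, P.map (X i) = μ) (hk : 1 ≤ k) (f g : Lp ℝ 2 μ) {b r : ℝ}
    (hb : 0 < b) (hr : 0 ≤ r) (hd : psiTwoDist μ f g ≠ ∞)
    (h : psiTwoNorm μ (⇑f + ⇑g) < ENNReal.ofReal b) :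
    P {ω | (10 * max (√r) r) * ((psiTwoDist μ f g).toReal * b) <
        |empiricalZ μ X f ω - empiricalZ μ X g ω|} ≤
      ENNReal.ofReal (2 * Real.exp (-(k * r))) := by
  have hf := measurable_coeFn_Lp f
  have hg := measurable_coeFn_Lp g
  -- The exponential moment is available only strictly above the `ψ₂` distance, whence the limit; it
  -- also covers distance zero.
  refine measure_lt_le_of_forall_gt (psiTwoDist μ f g).toReal
    (g := fun x => (10 * max (√r) r) * (x * b)) (by fun_prop) ?_ fun x hx => ?_
  · intro x _ y _ hxy
    dsimp only
    gcongr
  · have hx0 : 0 < x := lt_of_le_of_lt ENNReal.toReal_nonneg hx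
    have hdx : psiTwoNorm μ (⇑f - ⇑g) < ENNReal.ofReal x := by
      rw [← psiTwoDist_eq]
      exact (ENNReal.lt_ofReal_iff_toReal_lt hd).2 hx
    simp only [empiricalZ_sub]
    refine measure_lt_abs_sum_sub_mean_le hX hind hlaw hk (Y := fun x => f x ^ 2 - g x ^ 2)
      (by fun_prop) (by positivity) hr ?_
    have := lintegral_exp_mul_div_le_two (hf.sub hg)
      (lintegral_exp_sq_div_le_two_of_psiTwoNorm_lt hdx)
      (lintegral_exp_sq_div_le_two_of_psiTwoNorm_lt h)
    have e (x : Ω) : f x ^ 2 - g x ^ 2 = (⇑f - ⇑g) x * (⇑f + ⇑g) x := by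
      simp only [Pi.sub_apply, Pi.add_apply]; ring
    simpa only [e] using this

lemma measure_lt_sum_sq_sub_le (hX : ∀ i, Measurable (X i)) (hind : iIndepFun X P)
    (hlaw : ∀ i, P.map (X i) = μ) (f g : Lp ℝ 2 μ) {t : ℝ} (ht : 0 ≤ t)
    (hd : psiTwoDist μ f g ≠ ∞) :
    P {ω | t * (psiTwoDist μ f g).toReal ^ 2 < ∑ i, (f (X i ω) - g (X i ω)) ^ 2} ≤
      ENNReal.ofReal (Real.exp (k - t)) := by
  have hf := measurable_coeFn_Lp f
  have hg := measurable_coeFn_Lp g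
  refine measure_lt_le_of_forall_gt (psiTwoDist μ f g).toReal
    (g := fun x => t * x ^ 2) (by fun_prop) ?_ fun x hx => ?_
  · intro x hx y _ hxy
    have : 0 ≤ x := ENNReal.toReal_nonneg.trans hx
    dsimp only
    gcongr
  · have hx0 : 0 < x := lt_of_le_of_lt ENNReal.toReal_nonneg hx
    have hdx : psiTwoNorm μ (⇑f - ⇑g) < ENNReal.ofReal x := by
      rw [← psiTwoDist_eq]
      exact (ENNReal.lt_ofReal_iff_toReal_lt hd).2 hx
    exact measure_lt_sum_sq_le hX hind hlaw (hf.sub hg) hx0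
      (lintegral_exp_sq_div_le_two_of_psiTwoNorm_lt hdx)

end Tails

/-! ### Deterministic chaining. -/

section Chaining

lemma norm_sub_le_sum_Ico {W : Type*} [SeminormedAddCommGroup W] (w : ℕ → W) {i j : ℕ}
    (hij : i ≤ j) : ‖w j - w i‖ ≤ ∑ s ∈ Finset.Ico i j, ‖w (s + 1) - w s‖ := by
  rw [← Finset.sum_Ico_sub w hij]
  exact norm_sum_le _ _

/-- The deterministic part of the chaining argument: below the level `S` one follows the increments
of `Z`, from `S` on those of the vectors `v`, whose squared norm is `k (1 + Z)`. -/
lemma abs_le_of_chain {E V : Type*} [SeminormedAddCommGroup V] {Z : E → ℝ} {v : E → V} {k : ℝ}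
    (hk : 0 < k) {f : E} {p : ℕ → E} (hZf : ‖v f‖ ^ 2 = k * (1 + Z f))
    (hZp : ∀ s, ‖v (p s)‖ ^ 2 = k * (1 + Z (p s))) (hev : ∃ N, ∀ s ≥ N, p s = f) {m S : ℕ}
    (hmS : m ≤ S) {δ : ℕ → ℝ} (hδ : ∀ s, 0 ≤ δ s) {A b c Γ : ℝ} (hb : 0 ≤ b) (hc : 0 ≤ c)
    (hΓ : ∀ n, ∑ s ∈ Finset.range n, √2 ^ s * δ s ≤ Γ) (hA : |Z (p m)| ≤ A)
    (hZ : ∀ s, m ≤ s → s < S → |Z (p (s + 1)) - Z (p s)| ≤ b * √2 ^ s * (δ s + δ (s + 1)))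
    (hv : ∀ s, S ≤ s → ‖v (p (s + 1)) - v (p s)‖ ≤ c * √2 ^ s * (δ s + δ (s + 1))) :
    |Z f| ≤ 2 * (A + 2 * b * Γ) + 2 * (2 * c * Γ / √k) ^ 2 + 2 * (2 * c * Γ / √k) := by
  have h2 : (1 : ℝ) ≤ √2 := Real.one_le_sqrt.2 one_le_two
  have hsum (i j : ℕ) (hij : i ≤ j) :
      ∑ s ∈ Finset.Ico i j, √2 ^ s * (δ s + δ (s + 1)) ≤ 2 * Γ := by
    calc ∑ s ∈ Finset.Ico i j, √2 ^ s * (δ s + δ (s + 1))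
        ≤ ∑ s ∈ Finset.range j, √2 ^ s * (δ s + δ (s + 1)) := by
          rw [Finset.range_eq_Ico]
          refine Finset.sum_le_sum_of_subset_of_nonneg
            (Finset.Ico_subset_Ico_left (Nat.zero_le _)) fun s _ _ => ?_
          have := hδ s
          have := hδ (s + 1)
          positivity
      _ ≤ ∑ s ∈ Finset.range j, √2 ^ s * δ s +
            ∑ s ∈ Finset.range j, √2 ^ (s + 1) * δ (s + 1) := by
          rw [← Finset.sum_add_distrib]
          refine Finset.sum_le_sum fun s _ => ?_
          have := hδ (s + 1)
          rw [mul_add]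
          gcongr
          · omega
      _ ≤ Γ + ∑ s ∈ Finset.range (j + 1), √2 ^ s * δ s := by
          rw [Finset.sum_range_succ' _ j]
          have := hδ 0
          have := hΓ j
          simp only [pow_zero, one_mul]
          linarith
      _ ≤ 2 * Γ := by have := hΓ (j + 1); linarith
  have hΓ0 : 0 ≤ Γ := by simpa using hΓ 0
  have hZS : |Z (p S)| ≤ A + 2 * b * Γ := by
    have h1 : |Z (p S) - Z (p m)| ≤ 2 * b * Γ := by
      refine (norm_sub_le_sum_Ico (fun s => Z (p s)) hmS).trans ?_
      calc _ ≤ ∑ s ∈ Finset.Ico m S, b * (√2 ^ s * (δ s + δ (s + 1))) := by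
            refine Finset.sum_le_sum fun s hs => ?_
            rw [Finset.mem_Ico] at hs
            rw [← mul_assoc]
            exact hZ s hs.1 hs.2
        _ ≤ b * (2 * Γ) := by
            rw [← Finset.mul_sum]
            exact mul_le_mul_of_nonneg_left (hsum m S hmS) hb
        _ = _ := by ring
    have := abs_sub_abs_le_abs_sub (Z (p S)) (Z (p m))
    linarith
  have hvS : ‖v f - v (p S)‖ ≤ 2 * c * Γ := by
    obtain ⟨N, hN⟩ := hev
    have hSM : S ≤ max S N := le_max_left _ _
    rw [← hN (max S N) (le_max_right _ _)]
    refine (norm_sub_le_sum_Ico (fun s => v (p s)) hSM).trans ?_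
    calc _ ≤ ∑ s ∈ Finset.Ico S (max S N), c * (√2 ^ s * (δ s + δ (s + 1))) := by
          refine Finset.sum_le_sum fun s hs => ?_
          rw [Finset.mem_Ico] at hs
          rw [← mul_assoc]
          exact hv s hs.1
      _ ≤ c * (2 * Γ) := by
          rw [← Finset.mul_sum]
          exact mul_le_mul_of_nonneg_left (hsum S _ hSM) hc
      _ = _ := by ring
  set B := A + 2 * b * Γ
  set R := 2 * c * Γ / √k with hR
  have hsk : 0 < √k := Real.sqrt_pos.2 hk
  have hR0 : 0 ≤ R := by positivity
  have hB0 : 0 ≤ B := (abs_nonneg _).trans hZS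
  have hvR : ‖v f - v (p S)‖ ≤ √k * R := by
    rw [hR]; field_simp; exact hvS
  have hnp : ‖v (p S)‖ ≤ √k * √(1 + B) := by
    rw [← Real.sqrt_mul hk.le]
    refine Real.le_sqrt_of_sq_le ?_
    rw [hZp]
    gcongr
    exact (le_abs_self _).trans hZS
  -- Back from `v` to `Z`, by factoring the difference of the squared norms.
  have hdiff : |Z f - Z (p S)| ≤ R * (2 * √(1 + B) + R) := by
    have h1 : k * |Z f - Z (p S)| = |‖v f‖ ^ 2 - ‖v (p S)‖ ^ 2| := by
      rw [hZf, hZp, ← mul_sub, abs_mul, abs_of_pos hk]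
      ring_nf
    have h3 : |‖v f‖ - ‖v (p S)‖| ≤ √k * R := (abs_norm_sub_norm_le _ _).trans hvR
    have h4 : |‖v f‖ + ‖v (p S)‖| ≤ √k * (2 * √(1 + B) + R) := by
      rw [abs_of_nonneg (by positivity)]
      have := (le_abs_self _).trans h3
      linarith
    have h5 : k * |Z f - Z (p S)| ≤ k * (R * (2 * √(1 + B) + R)) := by
      rw [h1, sq_sub_sq, abs_mul]
      calc _ ≤ (√k * (2 * √(1 + B) + R)) * (√k * R) := by gcongr
        _ = √k * √k * (R * (2 * √(1 + B) + R)) := by ring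
        _ = _ := by rw [Real.mul_self_sqrt hk.le]
    exact le_of_mul_le_mul_left h5 hk
  have hs : √(1 + B) ≤ 1 + √B := by
    rw [Real.sqrt_le_left (by positivity)]
    nlinarith [Real.sq_sqrt hB0, Real.sqrt_nonneg B]
  -- The cross term is absorbed here, which accounts for the factors `2` in front of `B` and `R ^
  -- 2`.
  have h6 : 2 * R * √B ≤ R ^ 2 + B := by
    nlinarith [Real.sq_sqrt hB0, sq_nonneg (R - √B)]
  have h7 := abs_sub_abs_le_abs_sub (Z f) (Z (p S))
  have h8 : R * (2 * √(1 + B) + R) ≤ R * (2 * (1 + √B) + R) := by gcongr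
  nlinarith

end Chaining

/-! ### Normalization on the unit sphere. -/

section Sphere

variable {Ω : Type*} [MeasurableSpace Ω] {μ : Measure Ω}

lemma integral_sq_eq_one {f : Lp ℝ 2 μ} (hf : f ∈ Metric.sphere (0 : Lp ℝ 2 μ) 1) :
    ∫ x, (f x) ^ 2 ∂μ = 1 := by
  have h := real_inner_self_eq_norm_sq f
  rw [L2.inner_def, mem_sphere_zero_iff_norm.1 hf] at h
  simpa [sq] using h

lemma one_le_psiTwoNorm_of_mem_sphere [IsProbabilityMeasure μ] {f : Lp ℝ 2 μ}
    (hf : f ∈ Metric.sphere (0 : Lp ℝ 2 μ) 1) : 1 ≤ psiTwoNorm μ f := by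
  refine one_le_psiTwoNorm ?_
  rw [← ofReal_integral_eq_lintegral_ofReal (Lp.memLp f).integrable_sq
    (ae_of_all _ fun x => sq_nonneg _), integral_sq_eq_one hf, ENNReal.ofReal_one]

end Sphere

/-! ### Numerical estimates for the union bound. -/

lemma sqrt_two_pow_div (s k : ℕ) : √((2 : ℝ) ^ s / k) = √2 ^ s / √k := by
  rw [Real.sqrt_div (by positivity)]
  congr 1
  rw [Real.sqrt_eq_iff_mul_self_eq (by positivity) (by positivity), ← mul_pow,
    Real.mul_self_sqrt zero_le_two]

lemma max_sqrt_mul_le {c y : ℝ} (hc : 1 ≤ c) :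
    max (√(c * y)) (c * y) ≤ c * max (√y) y := by
  have hc0 : 0 ≤ c := by linarith
  refine max_le ?_ (mul_le_mul_of_nonneg_left (le_max_right _ _) hc0)
  rw [Real.sqrt_mul hc0]
  refine mul_le_mul ?_ (le_max_left _ _) (by positivity) hc0
  rw [Real.sqrt_le_left hc0]
  nlinarith

/-- The number of links at level `s` is at most `2 ^ (2 ^ (s+1)) * 2 ^ (2 ^ (s+2)) = 2 ^ (6 * 2 ^
s)`. -/
lemma natCast_mul_two_mul_exp_le {n s : ℕ} {u : ℝ} (hu : 1 ≤ u) (hn : n ≤ 2 ^ (6 * 2 ^ s)) :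
    (n : ℝ≥0∞) * ENNReal.ofReal (2 * Real.exp (-(10 * u * 2 ^ s))) ≤
      ENNReal.ofReal (Real.exp (-(3 * u * 2 ^ s))) := by
  rw [← ENNReal.ofReal_natCast, ← ENNReal.ofReal_mul (by positivity)]
  refine ENNReal.ofReal_le_ofReal ?_
  have hx : (1 : ℝ) ≤ 2 ^ s := one_le_pow₀ one_le_two
  have h2 : (2 : ℝ) ≤ Real.exp 1 := by
    have := Real.add_one_le_exp 1
    linarith
  have h1 : (n : ℝ) ≤ Real.exp (6 * 2 ^ s) := by
    calc (n : ℝ) ≤ 2 ^ (6 * 2 ^ s) := by exact_mod_cast hn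
      _ ≤ Real.exp 1 ^ (6 * 2 ^ s) := by gcongr
      _ = _ := by rw [← Real.exp_nat_mul]; push_cast; ring_nf
  have h3 : (2 : ℝ) ≤ Real.exp (2 ^ s) := h2.trans (Real.exp_le_exp.2 hx)
  calc (n : ℝ) * (2 * Real.exp (-(10 * u * 2 ^ s)))
      ≤ Real.exp (6 * 2 ^ s) * (Real.exp (2 ^ s) * Real.exp (-(10 * u * 2 ^ s))) := by gcongr
    _ = Real.exp (7 * 2 ^ s - 10 * u * 2 ^ s) := by
        rw [← Real.exp_add, ← Real.exp_add]; ring_nf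
    _ ≤ _ := by
        rw [Real.exp_le_exp]
        nlinarith [mul_le_mul_of_nonneg_right hu (by positivity : (0 : ℝ) ≤ 2 ^ s)]

lemma exp_add_tsum_exp_le {u : ℝ} (hu : 1 ≤ u) (m : ℕ) :
    ENNReal.ofReal (Real.exp (-(3 * u * 2 ^ m))) +
      ∑' j : ℕ, ENNReal.ofReal (Real.exp (-(3 * u * 2 ^ (m + j)))) ≤
        ENNReal.ofReal (Real.exp (-(u * 2 ^ m))) := by
  have hm : (1 : ℝ) ≤ 2 ^ m := one_le_pow₀ one_le_two
  have hx : 1 ≤ u * 2 ^ m := one_le_mul_of_one_le_of_one_le hu hm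
  have h2 : (2 : ℝ) ≤ Real.exp 1 := by
    have := Real.add_one_le_exp 1
    linarith
  have hj (j : ℕ) : ENNReal.ofReal (Real.exp (-(3 * u * 2 ^ (m + j)))) ≤
      ENNReal.ofReal (Real.exp (-(3 * u * 2 ^ m))) * 2⁻¹ ^ j := by
    have h4 : (2⁻¹ : ℝ≥0∞) ^ j = ENNReal.ofReal (2⁻¹ ^ j) := by
      rw [ENNReal.ofReal_pow (by positivity), ENNReal.ofReal_inv_of_pos two_pos]; simp
    rw [h4, ← ENNReal.ofReal_mul (Real.exp_pos _).le]
    refine ENNReal.ofReal_le_ofReal ?_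
    have h3 : ((j : ℝ) + 1) ≤ 2 ^ j := by exact_mod_cast Nat.lt_two_pow_self
    calc Real.exp (-(3 * u * 2 ^ (m + j))) ≤ Real.exp (-(3 * u * 2 ^ m) + j * (-1)) := by
          rw [Real.exp_le_exp, pow_add]
          nlinarith [mul_le_mul hx h3 (by positivity) (by positivity)]
      _ = Real.exp (-(3 * u * 2 ^ m)) * (Real.exp 1)⁻¹ ^ j := by
          rw [Real.exp_add, Real.exp_nat_mul, Real.exp_neg 1]
      _ ≤ _ := by gcongr
  calc _ ≤ ENNReal.ofReal (Real.exp (-(3 * u * 2 ^ m))) +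
        ∑' j : ℕ, ENNReal.ofReal (Real.exp (-(3 * u * 2 ^ m))) * 2⁻¹ ^ j := by
        gcongr with j; exact hj j
    _ = ENNReal.ofReal (3 * Real.exp (-(3 * u * 2 ^ m))) := by
        rw [ENNReal.tsum_mul_left, ENNReal.tsum_geometric, ENNReal.one_sub_inv_two, inv_inv,
          ENNReal.ofReal_mul (by norm_num)]
        simp only [ENNReal.ofReal_ofNat]
        ring
    _ ≤ _ := by
        refine ENNReal.ofReal_le_ofReal ?_
        have h3 : (3 : ℝ) ≤ Real.exp (2 * (u * 2 ^ m)) := by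
          have := Real.add_one_le_exp (2 * (u * 2 ^ m))
          linarith
        calc _ ≤ Real.exp (2 * (u * 2 ^ m)) * Real.exp (-(3 * u * 2 ^ m)) := by gcongr
          _ = _ := by rw [← Real.exp_add]; ring_nf

/-! ### Union bound over all links of the chains. -/

section UnionBound

variable {Ω Ω' : Type*} [MeasurableSpace Ω] {μ : Measure Ω} [IsProbabilityMeasure μ]
  [MeasurableSpace Ω'] {P : Measure Ω'} [IsProbabilityMeasure P] {k : ℕ} {X : Fin k → Ω' → Ω}

theorem measure_exists_lt_abs_empiricalZ_le (hX : ∀ i, Measurable (X i)) (hind : iIndepFun X P)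
    (hlaw : ∀ i, P.map (X i) = μ) (hk : 1 ≤ k) {F : Set (Lp ℝ 2 μ)}
    (hF : F ⊆ Metric.sphere 0 1) {α : ℝ} (hα : 2 ≤ α)
    (hFα : ∀ f ∈ F, psiTwoNorm μ f ≤ ENNReal.ofReal (α / 2))
    {B : ℕ → Finset (Lp ℝ 2 μ)} (hBF : ∀ s, ∀ a ∈ B s, a ∈ F)
    (hBc : ∀ s, (B s).card ≤ 2 ^ 2 ^ (s + 1)) {G : Set (Lp ℝ 2 μ)}
    {p : Lp ℝ 2 μ → ℕ → Lp ℝ 2 μ} (hpB : ∀ f ∈ G, ∀ s, p f s ∈ B s)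
    (hpf : ∀ f ∈ G, ∃ N, ∀ s ≥ N, p f s = f) {Γ : ℝ}
    (hΓ : ∀ f ∈ G, ∀ n, ∑ s ∈ Finset.range n, √2 ^ s * (psiTwoDist μ f (p f s)).toReal ≤ Γ)
    (m : ℕ) {u : ℝ} (hu : 1 ≤ u) :
    P {ω | ∃ f ∈ G, 1000 * u * (α ^ 2 * max (√(2 ^ m / k)) (2 ^ m / k) + α * Γ / √k + Γ ^ 2 / k) <
      |empiricalZ μ X f ω|} ≤ ENNReal.ofReal (Real.exp (-(u * 2 ^ m))) := by
  have hk0 : (0 : ℝ) < k := by exact_mod_cast hk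
  have hu0 : 0 < u := by linarith
  have hα0 : 0 < α := by linarith
  have hfin {a b : Lp ℝ 2 μ} (ha : a ∈ F) (hb : b ∈ F) : psiTwoDist μ a b ≠ ∞ :=
    ne_top_of_le_ne_top (ENNReal.add_ne_top.2 ⟨ENNReal.ofReal_ne_top, ENNReal.ofReal_ne_top⟩)
      ((psiTwoDist_le_add a b).trans (add_le_add (hFα a ha) (hFα b hb)))
  -- The switching level: `2 ^ s ≤ k` for `m ≤ s < S`, and `k ≤ 2 * 2 ^ s` for `s ≥ S`.
  set S : ℕ := max m (Nat.log 2 k) with hS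
  have hlow {s : ℕ} (hms : m ≤ s) (hsS : s < S) : (2 : ℝ) ^ s ≤ k := by
    have : s ≤ Nat.log 2 k := by omega
    exact_mod_cast (Nat.pow_le_pow_right two_pos this).trans (Nat.pow_log_le_self 2 (by omega))
  have hhigh {s : ℕ} (hsS : S ≤ s) : (k : ℝ) ≤ 2 * 2 ^ s := by
    have h1 : k < 2 ^ (Nat.log 2 k + 1) := Nat.lt_pow_succ_log_self one_lt_two k
    have h2 : 2 ^ (Nat.log 2 k + 1) ≤ 2 ^ (s + 1) := Nat.pow_le_pow_right two_pos (by omega)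
    have h3 : k ≤ 2 * 2 ^ s := by rw [← pow_succ']; omega
    exact_mod_cast h3
  let r (s : ℕ) : ℝ := 10 * u * (2 ^ s / k)
  have hr0 (s : ℕ) : 0 ≤ r s := by positivity
  have hkr (s : ℕ) : k * r s = 10 * u * 2 ^ s := by simp only [r]; field_simp
  let start (a : Lp ℝ 2 μ) : Set Ω' :=
    {ω | (10 * max (√(r m)) (r m)) * α ^ 2 < |empiricalZ μ X a ω|}
  let link (s : ℕ) (a b : Lp ℝ 2 μ) : Set Ω' :=
    if s < S then
      {ω | (10 * max (√(r s)) (r s)) * ((psiTwoDist μ b a).toReal * (2 * α)) <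
        |empiricalZ μ X b ω - empiricalZ μ X a ω|}
    else {ω | 12 * u * 2 ^ s * (psiTwoDist μ b a).toReal ^ 2 <
      ∑ i, (b (X i ω) - a (X i ω)) ^ 2}
  have hstart {a : Lp ℝ 2 μ} (ha : a ∈ F) :
      P (start a) ≤ ENNReal.ofReal (2 * Real.exp (-(10 * u * 2 ^ m))) := by
    rw [← hkr]
    refine measure_lt_abs_empiricalZ_le hX hind hlaw hk a hα0 (hr0 m) ?_
    exact (hFα a ha).trans_lt ((ENNReal.ofReal_lt_ofReal_iff hα0).2 (by linarith))
  have hlink (s : ℕ) {a b : Lp ℝ 2 μ} (ha : a ∈ F) (hb : b ∈ F) :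
      P (link s a b) ≤ ENNReal.ofReal (2 * Real.exp (-(10 * u * 2 ^ s))) := by
    by_cases hs : s < S
    · simp only [link, if_pos hs]
      rw [← hkr]
      refine measure_lt_abs_empiricalZ_sub_le hX hind hlaw hk b a (by positivity) (hr0 s)
        (hfin hb ha) ?_
      refine (psiTwoNorm_add_le (measurable_coeFn_Lp b)).trans_lt ?_
      refine (add_le_add (hFα b hb) (hFα a ha)).trans_lt ?_
      rw [← ENNReal.ofReal_add (by positivity) (by positivity)]
      exact (ENNReal.ofReal_lt_ofReal_iff (by positivity)).2 (by linarith)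
    · simp only [link, if_neg hs]
      refine (measure_lt_sum_sq_sub_le hX hind hlaw b a (by positivity) (hfin hb ha)).trans ?_
      refine ENNReal.ofReal_le_ofReal ?_
      have h1 := hhigh (not_lt.1 hs)
      -- The constant `12` is `10` plus the `2` that pays for `k ≤ 2 * 2 ^ s`.
      have h2 : Real.exp (k - 12 * u * 2 ^ s) ≤ Real.exp (-(10 * u * 2 ^ s)) := by
        rw [Real.exp_le_exp]
        nlinarith [mul_le_mul_of_nonneg_right hu (by positivity : (0 : ℝ) ≤ 2 ^ s)]
      have := Real.exp_pos (-(10 * u * 2 ^ s))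
      linarith
  set bad : Set Ω' := (⋃ a ∈ B m, start a) ∪
    ⋃ j : ℕ, ⋃ q ∈ B (m + j) ×ˢ B (m + j + 1), link (m + j) q.1 q.2 with hbad
  have hPbad : P bad ≤ ENNReal.ofReal (Real.exp (-(u * 2 ^ m))) := by
    refine le_trans ?_ (exp_add_tsum_exp_le hu m)
    refine (measure_union_le _ _).trans (add_le_add ?_ ((measure_iUnion_le _).trans ?_))
    · refine (measure_biUnion_finset_le _ _).trans ?_
      refine (Finset.sum_le_card_nsmul _ _ _ fun a ha => hstart (hBF m a ha)).trans ?_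
      rw [nsmul_eq_mul]
      refine natCast_mul_two_mul_exp_le hu ((hBc m).trans (Nat.pow_le_pow_right two_pos ?_))
      rw [pow_succ]; omega
    · refine ENNReal.tsum_le_tsum fun j => ?_
      refine (measure_biUnion_finset_le _ _).trans ?_
      refine (Finset.sum_le_card_nsmul _ _ _ fun q hq => hlink (m + j) (hBF _ _
        (Finset.mem_product.1 hq).1) (hBF _ _ (Finset.mem_product.1 hq).2)).trans ?_
      rw [nsmul_eq_mul]
      refine natCast_mul_two_mul_exp_le hu ?_
      rw [Finset.card_product]
      refine (Nat.mul_le_mul (hBc _) (hBc _)).trans ?_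
      rw [← pow_add]
      refine Nat.pow_le_pow_right two_pos ?_
      rw [pow_succ, pow_succ, pow_succ]; omega
  refine (measure_mono ?_).trans hPbad
  rintro ω ⟨f, hf, hlt⟩
  by_contra hω
  have hpF (s : ℕ) : p f s ∈ F := hBF s _ (hpB f hf s)
  obtain ⟨N, hN⟩ := hpf f hf
  have hfF : f ∈ F := hN N le_rfl ▸ hpF N
  simp only [hbad, Set.mem_union, Set.mem_iUnion, not_or, not_exists] at hω
  obtain ⟨hω0, hω1⟩ := hω
  have hω1' (s : ℕ) (hs : m ≤ s) : ω ∉ link s (p f s) (p f (s + 1)) := by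
    obtain ⟨j, rfl⟩ := Nat.exists_eq_add_of_le hs
    exact hω1 j (p f (m + j), p f (m + j + 1))
      (Finset.mem_product.2 ⟨hpB f hf _, hpB f hf _⟩)
  let v (a : Lp ℝ 2 μ) : EuclideanSpace ℝ (Fin k) := WithLp.toLp 2 fun i => a (X i ω)
  have hv (a : Lp ℝ 2 μ) (ha : a ∈ F) : ‖v a‖ ^ 2 = k * (1 + empiricalZ μ X a ω) := by
    rw [EuclideanSpace.real_norm_sq_eq, empiricalZ, integral_sq_eq_one (hF ha)]
    simp only [v]
    field_simp
    ring
  let δ (s : ℕ) : ℝ := (psiTwoDist μ f (p f s)).toReal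
  have hδ (s : ℕ) : (psiTwoDist μ (p f (s + 1)) (p f s)).toReal ≤ δ s + δ (s + 1) := by
    rw [add_comm (δ s)]
    simp only [δ]
    rw [psiTwoDist_comm f (p f (s + 1)), ← ENNReal.toReal_add (hfin (hpF _) hfF) (hfin hfF (hpF _))]
    exact ENNReal.toReal_mono (ENNReal.add_ne_top.2 ⟨hfin (hpF _) hfF, hfin hfF (hpF _)⟩)
      (psiTwoDist_triangle _ _ _)
  have hc10 : 1 ≤ 10 * u := by linarith
  have key := abs_le_of_chain (Z := fun a => empiricalZ μ X a ω) (v := v) hk0 (hv f hfF)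
    (fun s => hv _ (hpF s)) ⟨N, hN⟩ (le_max_left m (Nat.log 2 k))
    (δ := δ) (fun s => ENNReal.toReal_nonneg)
    (A := 100 * u * α ^ 2 * max (√(2 ^ m / k)) (2 ^ m / k)) (b := 200 * u * α / √k)
    (c := √(12 * u)) (by positivity) (by positivity) (hΓ f hf) ?_ ?_ ?_
  · have hΓ0 : 0 ≤ Γ := by simpa using hΓ f hf 0
    have hsk : 0 < √(k : ℝ) := Real.sqrt_pos.2 hk0
    have h1 : √(12 * u) ≤ 4 * u := by
      rw [Real.sqrt_le_left (by positivity)]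
      nlinarith
    have h2 : (2 * √(12 * u) * Γ / √k) ^ 2 = 48 * u * (Γ ^ 2 / k) := by
      rw [div_pow, mul_pow, mul_pow, Real.sq_sqrt (by positivity), Real.sq_sqrt hk0.le]
      ring
    have h3 : 2 * √(12 * u) * Γ / √k ≤ 4 * u * (α * Γ / √k) := by
      calc 2 * √(12 * u) * Γ / √k ≤ α * (4 * u) * Γ / √k := by gcongr
        _ = _ := by ring
    have h4 : 2 * (200 * u * α / √k) * Γ = 400 * u * (α * Γ / √k) := by ring
    rw [h2, h4] at key
    have h5 : 0 ≤ u * (α * Γ / √k) := by positivity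
    have h6 : 0 ≤ u * (Γ ^ 2 / k) := by positivity
    have h7 : 0 ≤ u * (α ^ 2 * max (√(2 ^ m / (k : ℝ))) (2 ^ m / k)) := by positivity
    linarith
  · have h1 : ω ∉ start (p f m) := hω0 _ (hpB f hf m)
    simp only [start, Set.mem_ofPred_eq, not_lt] at h1
    refine h1.trans ?_
    calc _ ≤ 10 * (10 * u * max (√(2 ^ m / k)) (2 ^ m / k)) * α ^ 2 := by
          gcongr; exact max_sqrt_mul_le hc10
      _ = _ := by ring
  · intro s hms hsS
    have h1 := hω1' s hms
    simp only [link] at h1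
    rw [if_pos hsS, Set.mem_ofPred_eq, not_lt] at h1
    refine h1.trans ?_
    have h2 : (2 : ℝ) ^ s / k ≤ 1 := (div_le_one hk0).2 (hlow hms hsS)
    -- Below `S` Bernstein is in its Gaussian regime.
    have h3 : max (√(2 ^ s / k)) ((2 : ℝ) ^ s / k) = √2 ^ s / √k := by
      rw [max_eq_left, sqrt_two_pow_div]
      exact Real.le_sqrt_of_sq_le (by nlinarith [(by positivity : (0 : ℝ) ≤ 2 ^ s / k)])
    calc _ ≤ 10 * (10 * u * (√2 ^ s / √k)) * ((δ s + δ (s + 1)) * (2 * α)) := by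
          rw [← h3]
          gcongr
          · exact max_sqrt_mul_le hc10
          · exact hδ s
      _ = _ := by ring
  · intro s hsS
    have h1 := hω1' s ((le_max_left _ _).trans hsS)
    simp only [link] at h1
    rw [if_neg (not_lt.2 hsS), Set.mem_ofPred_eq, not_lt] at h1
    have hδ0 : 0 ≤ δ s + δ (s + 1) := ENNReal.toReal_nonneg.trans (hδ s)
    refine (sq_le_sq₀ (norm_nonneg _) (by positivity)).1 ?_
    calc ‖v (p f (s + 1)) - v (p f s)‖ ^ 2
        = ∑ i, (p f (s + 1) (X i ω) - p f s (X i ω)) ^ 2 := by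
          rw [EuclideanSpace.real_norm_sq_eq]
          rfl
      _ ≤ 12 * u * 2 ^ s * (psiTwoDist μ (p f (s + 1)) (p f s)).toReal ^ 2 := h1
      _ ≤ 12 * u * 2 ^ s * (δ s + δ (s + 1)) ^ 2 := by gcongr; exact hδ s
      _ = _ := by
          rw [mul_pow, mul_pow, Real.sq_sqrt (by positivity), ← pow_mul, mul_comm s 2, pow_mul,
            Real.sq_sqrt zero_le_two]

end UnionBound

/-! ### Admissible sequences, and `α` against `γ₂`. -/

section Admissible

variable {Ω : Type*} [MeasurableSpace Ω] {μ : Measure Ω}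

lemma psiTwoDist_self [IsProbabilityMeasure μ] (f : Lp ℝ 2 μ) : psiTwoDist μ f f = 0 := by
  rw [psiTwoDist_eq, sub_self, ← nonpos_iff_eq_zero]
  refine ENNReal.le_of_forall_pos_le_add fun ε hε _ => ?_
  rw [zero_add, ← ENNReal.ofReal_coe_nnreal]
  exact psiTwoNorm_le_ofReal (by exact_mod_cast hε) (by simp)

lemma IsAdmissible.finite {E : Type*} {T : Set E} {A : ℕ → Set E} (hA : IsAdmissible T A) (s : ℕ) :
    (A s).Finite := by
  rcases s with _ | s
  · exact Set.finite_of_encard_eq_coe (k := 1) (by rw [hA.card_zero, Nat.cast_one])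
  · exact Set.finite_of_encard_le_coe (hA.card_le (s + 1) (by omega))

lemma IsAdmissible.ncard_le {E : Type*} {T : Set E} {A : ℕ → Set E} (hA : IsAdmissible T A)
    (s : ℕ) : (A s).ncard ≤ 2 ^ 2 ^ s := by
  have h : (A s).encard ≤ ((2 ^ 2 ^ s : ℕ) : ℕ∞) := by
    rcases s with _ | s
    · rw [hA.card_zero]; exact_mod_cast Nat.one_le_two_pow
    · exact hA.card_le _ (by omega)
  rw [← (hA.finite s).cast_ncard_eq] at h
  exact_mod_cast h

lemma toReal_two_rpow_half (s : ℕ) : ((2 : ℝ≥0∞) ^ ((s : ℝ) / 2)).toReal = √2 ^ s := by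
  rw [← ENNReal.toReal_rpow, ENNReal.toReal_ofNat, Real.sqrt_eq_rpow, ← Real.rpow_mul_natCast
    zero_le_two]
  ring_nf

/-- Adding the first points of an enumeration of `G` to an admissible sequence gives finite sets
in which every chain of nearest points of some `f ∈ G` ends at `f`. -/
lemma exists_terminating_chains [IsProbabilityMeasure μ] {F G : Set (Lp ℝ 2 μ)}
    {A : ℕ → Set (Lp ℝ 2 μ)} (hA : IsAdmissible F A) (hGF : G ⊆ F) (hG : G.Countable) {Γ : ℝ}
    (hΓ0 : 0 ≤ Γ)
    (hΓ : ⨆ f ∈ F, ∑' s : ℕ, (2 : ℝ≥0∞) ^ ((s : ℝ) / 2) * ⨅ a ∈ A s, psiTwoDist μ f a ≤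
      ENNReal.ofReal Γ) :
    ∃ (B : ℕ → Finset (Lp ℝ 2 μ)) (p : Lp ℝ 2 μ → ℕ → Lp ℝ 2 μ),
      (∀ s, ∀ a ∈ B s, a ∈ F) ∧ (∀ s, (B s).card ≤ 2 ^ 2 ^ (s + 1)) ∧
      (∀ f ∈ G, ∀ s, p f s ∈ B s) ∧ (∀ f ∈ G, ∃ N, ∀ s ≥ N, p f s = f) ∧
      ∀ f ∈ G, ∀ n,
        ∑ s ∈ Finset.range n, √2 ^ s * (psiTwoDist μ f (p f s)).toReal ≤ Γ := by
  classical
  obtain ⟨g, hg⟩ := Set.countable_iff_exists_subset_range.1 hG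
  let B (s : ℕ) : Finset (Lp ℝ 2 μ) :=
    -- The range of `g` may be larger than `G`; the filter keeps the added points in `F`.
    (hA.finite s).toFinset ∪ ((Finset.range (s + 1)).image g).filter (· ∈ F)
  have hex (f : Lp ℝ 2 μ) (s : ℕ) : ∃ q ∈ B s, (f ∈ B s → q = f) ∧
      psiTwoDist μ f q ≤ ⨅ a ∈ A s, psiTwoDist μ f a := by
    by_cases hf : f ∈ B s
    · exact ⟨f, hf, fun _ => rfl, by rw [psiTwoDist_self]; exact zero_le⟩
    · obtain ⟨q, hq, hmin⟩ := Set.exists_min_image (A s) (psiTwoDist μ f) (hA.finite s)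
        (hA.nonempty s)
      exact ⟨q, Finset.mem_union_left _ ((hA.finite s).mem_toFinset.2 hq), fun h => absurd h hf,
        le_iInf₂ hmin⟩
  choose p hpB hpf hpd using hex
  refine ⟨B, p, fun s a ha => ?_, fun s => ?_, fun f _ s => hpB f s, fun f hf => ?_,
    fun f hf n => ?_⟩
  · rcases Finset.mem_union.1 ha with h | h
    · exact hA.subset s ((hA.finite s).mem_toFinset.1 h)
    · exact (Finset.mem_filter.1 h).2
  · have h1 : (hA.finite s).toFinset.card ≤ 2 ^ 2 ^ s := by
      rw [← Set.ncard_eq_toFinset_card _ (hA.finite s)]; exact hA.ncard_le s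
    have h2 : (((Finset.range (s + 1)).image g).filter (· ∈ F)).card ≤ s + 1 :=
      (Finset.card_filter_le _ _).trans (Finset.card_image_le.trans (by simp))
    have h3 : s + 1 ≤ 2 ^ s := Nat.lt_two_pow_self
    have h4 : 2 ^ s < 2 ^ 2 ^ s := Nat.lt_two_pow_self
    have h5 : 2 ≤ 2 ^ 2 ^ s := by
      calc 2 = 2 ^ 1 := rfl
        _ ≤ 2 ^ 2 ^ s := Nat.pow_le_pow_right two_pos Nat.one_le_two_pow
    refine (Finset.card_union_le _ _).trans ?_
    rw [pow_succ 2 s, pow_mul, sq]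
    nlinarith
  · obtain ⟨N, rfl⟩ := hg hf
    refine ⟨N, fun s hs => hpf _ s (Finset.mem_union_right _ (Finset.mem_filter.2 ⟨?_, hGF hf⟩))⟩
    exact Finset.mem_image_of_mem g (Finset.mem_range.2 (by omega))
  · have h1 : ∑ s ∈ Finset.range n, (2 : ℝ≥0∞) ^ ((s : ℝ) / 2) * psiTwoDist μ f (p f s) ≤
        ENNReal.ofReal Γ := by
      refine le_trans ?_ ((le_iSup₂ (f := fun f (_ : f ∈ F) => ∑' s : ℕ,
        (2 : ℝ≥0∞) ^ ((s : ℝ) / 2) * ⨅ a ∈ A s, psiTwoDist μ f a) f (hGF hf)).trans hΓ)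
      refine le_trans ?_ (ENNReal.sum_le_tsum (Finset.range n))
      exact Finset.sum_le_sum fun s _ => mul_le_mul_right (hpd f s) _
    have h2 := ENNReal.toReal_mono ENNReal.ofReal_ne_top h1
    rw [ENNReal.toReal_ofReal hΓ0, ENNReal.toReal_sum] at h2
    · simpa only [ENNReal.toReal_mul, toReal_two_rpow_half] using h2
    · intro s hs
      exact ne_top_of_le_ne_top ENNReal.ofReal_ne_top
        ((Finset.single_le_sum (f := fun s : ℕ => (2 : ℝ≥0∞) ^ ((s : ℝ) / 2) *
          psiTwoDist μ f (p f s)) (fun _ _ => zero_le) hs).trans h1)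

lemma two_mul_psiTwoNorm_le (Y : Ω → ℝ) : 2 * psiTwoNorm μ Y ≤ psiTwoNorm μ (Y + Y) := by
  refine le_iInf fun u => le_iInf fun hu => le_iInf fun h => ?_
  have h1 : psiTwoNorm μ Y ≤ ENNReal.ofReal (u / 2) := by
    refine psiTwoNorm_le_ofReal (by positivity) (le_of_eq_of_le ?_ h)
    refine lintegral_congr fun x => ?_
    congr 2
    simp only [Pi.add_apply]
    field_simp
    ring
  calc 2 * psiTwoNorm μ Y ≤ 2 * ENNReal.ofReal (u / 2) := by gcongr
    _ = ENNReal.ofReal u := by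
      rw [← ENNReal.ofReal_ofNat 2, ← ENNReal.ofReal_mul zero_le_two]; congr 1; ring

/-- Only the term `s = 0` is needed: both `f` and `-f` are within the chaining sum of the single
point of `A 0`, and their distance is at least `2 ‖f‖_{ψ₂}`. -/
lemma psiTwoDiam_le_two_mul_gammaTwo {F : Set (Lp ℝ 2 μ)} (hF : ∀ f ∈ F, -f ∈ F) :
    psiTwoDiam μ F ≤ 2 * gammaTwo (psiTwoDist μ) F := by
  refine mul_le_mul_right (iSup₂_le fun f hf => le_iInf₂ fun A hA => ?_) _
  obtain ⟨a, ha⟩ := Set.encard_eq_one.1 hA.card_zero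
  set M := ⨆ f ∈ F, ∑' s : ℕ, (2 : ℝ≥0∞) ^ ((s : ℝ) / 2) * ⨅ a ∈ A s, psiTwoDist μ f a with hM
  have hle {g : Lp ℝ 2 μ} (hg : g ∈ F) : psiTwoDist μ g a ≤ M := by
    refine le_trans ?_ (le_iSup₂ (f := fun f (_ : f ∈ F) => ∑' s : ℕ,
      (2 : ℝ≥0∞) ^ ((s : ℝ) / 2) * ⨅ a ∈ A s, psiTwoDist μ f a) g hg)
    refine le_trans ?_ (ENNReal.le_tsum 0)
    simp [ha]
  have h1 : 2 * psiTwoNorm μ f ≤ 2 * M := by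
    calc 2 * psiTwoNorm μ f ≤ psiTwoNorm μ (⇑f + ⇑f) := two_mul_psiTwoNorm_le _
      _ = psiTwoDist μ f (-f) := by
        rw [psiTwoDist_eq]
        refine psiTwoNorm_congr_sq_ae ((Lp.coeFn_neg f).mono fun x hx => ?_)
        rw [Pi.add_apply, Pi.sub_apply, hx, Pi.neg_apply, sub_neg_eq_add]
      _ ≤ psiTwoDist μ f a + psiTwoDist μ a (-f) := psiTwoDist_triangle _ _ _
      _ ≤ M + M := by
        rw [psiTwoDist_comm a]
        exact add_le_add (hle hf) (hle (hF f hf))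
      _ = 2 * M := (two_mul M).symm
  exact (ENNReal.mul_le_mul_iff_right two_ne_zero ENNReal.ofNat_ne_top).1 h1

lemma two_le_psiTwoDiam [IsProbabilityMeasure μ] {F : Set (Lp ℝ 2 μ)}
    (hF : F ⊆ Metric.sphere 0 1) (hne : F.Nonempty) : 2 ≤ psiTwoDiam μ F := by
  obtain ⟨f, hf⟩ := hne
  calc (2 : ℝ≥0∞) = 2 * 1 := by simp
    _ ≤ psiTwoDiam μ F := by
      refine mul_le_mul_right ((one_le_psiTwoNorm_of_mem_sphere (hF hf)).trans ?_) _
      exact le_iSup₂ (f := fun f (_ : f ∈ F) => psiTwoNorm μ f) f hf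

end Admissible

lemma ofReal_chainingBound {Ω : Type*} [MeasurableSpace Ω] {μ : Measure Ω} {k : ℕ} (hk : 1 ≤ k)
    {F : Set (Lp ℝ 2 μ)} (hα : psiTwoDiam μ F ≠ ∞) (hγ : gammaTwo (psiTwoDist μ) F ≠ ∞) :
    chainingBound μ k F = ENNReal.ofReal ((psiTwoDiam μ F).toReal *
      max ((gammaTwo (psiTwoDist μ) F).toReal / √k)
        ((gammaTwo (psiTwoDist μ) F).toReal ^ 2 / k)) := by
  have hk0 : (0 : ℝ) < k := by exact_mod_cast hk
  rw [ENNReal.ofReal_mul ENNReal.toReal_nonneg, ENNReal.ofReal_max,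
    ENNReal.ofReal_div_of_pos (Real.sqrt_pos.2 hk0), ENNReal.ofReal_div_of_pos hk0,
    ENNReal.ofReal_pow ENNReal.toReal_nonneg, ENNReal.ofReal_toReal hα, ENNReal.ofReal_toReal hγ,
    ENNReal.ofReal_natCast, Real.sqrt_eq_rpow, ← ENNReal.ofReal_rpow_of_pos hk0,
    ENNReal.ofReal_natCast]
  rfl

/-- Layer cake at the multiples of `K`: `Y ≤ K (1 + ∑ 1_{Y > (n+1) K})`. Measurable hulls stand in
for the level sets because `Y` need not be measurable. -/
lemma lintegral_le_two_mul_of_tail {α : Type*} [MeasurableSpace α] {P : Measure α}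
    [IsProbabilityMeasure P] {Y : α → ℝ≥0∞} {K : ℝ≥0∞} (hK : K ≠ 0)
    (h : ∀ n : ℕ, P {ω | (n + 1) * K < Y ω} ≤ 2⁻¹ ^ (n + 1)) : ∫⁻ ω, Y ω ∂P ≤ 2 * K := by
  classical
  let T (n : ℕ) : Set α := toMeasurable P {ω | (n + 1) * K < Y ω}
  have hT {n : ℕ} {ω : α} (hω : (n + 1) * K < Y ω) : (T n).indicator 1 ω = (1 : ℝ≥0∞) :=
    Set.indicator_of_mem
      (subset_toMeasurable P {ω | (n + 1) * K < Y ω} (show ω ∈ {ω | (n + 1) * K < Y ω} from hω)) _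
  have hmeas (n : ℕ) : Measurable ((T n).indicator (1 : α → ℝ≥0∞)) :=
    measurable_one.indicator (measurableSet_toMeasurable _ _)
  have hpt (ω : α) : Y ω ≤ K * (1 + ∑' n, (T n).indicator 1 ω) := by
    by_cases hex : ∃ n : ℕ, Y ω ≤ (n + 1) * K
    · have h1 : ((Nat.find hex : ℕ) : ℝ≥0∞) ≤ ∑' n, (T n).indicator 1 ω := by
        calc ((Nat.find hex : ℕ) : ℝ≥0∞)
            = ∑ n ∈ Finset.range (Nat.find hex), (T n).indicator 1 ω := by
              rw [Finset.sum_congr rfl fun n hn =>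
                hT (not_le.1 (Nat.find_min hex (Finset.mem_range.1 hn)))]
              simp
          _ ≤ _ := ENNReal.sum_le_tsum _
      refine (Nat.find_spec hex).trans ?_
      rw [mul_comm, add_comm]
      gcongr
    · push Not at hex
      have h1 : ∑' n, (T n).indicator 1 ω = (∞ : ℝ≥0∞) := by
        rw [tsum_congr fun n => hT (hex n)]
        simp
      simp [h1, ENNReal.mul_top hK]
  calc ∫⁻ ω, Y ω ∂P ≤ ∫⁻ ω, K * (1 + ∑' n, (T n).indicator 1 ω) ∂P := lintegral_mono hpt
    _ = K * (1 + ∑' n, P (T n)) := by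
        rw [lintegral_const_mul _ (by fun_prop),
          lintegral_add_left measurable_const, lintegral_tsum fun n => (hmeas n).aemeasurable]
        simp [T]
    _ ≤ K * (1 + ∑' n : ℕ, 2⁻¹ ^ (n + 1)) := by
        gcongr with n
        rw [measure_toMeasurable]
        exact h n
    _ = 2 * K := by
        rw [ENNReal.tsum_geometric_add_one, ENNReal.one_sub_inv_two, inv_inv,
          ENNReal.inv_mul_cancel two_ne_zero ENNReal.ofNat_ne_top, one_add_one_eq_two, mul_comm]

/-! ### Choice of the starting level and conclusion. -/

section Main

variable {Ω Ω' : Type*} [MeasurableSpace Ω] {μ : Measure Ω} [IsProbabilityMeasure μ]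
  [MeasurableSpace Ω'] {P : Measure Ω'} [IsProbabilityMeasure P] {k : ℕ} {X : Fin k → Ω' → Ω}

/-- Used with `x = 2 ^ m` and `Γ = 2γ`. Since `α √x ≤ 2γ`, the initial term is of the target order;
`α ≥ 2` supplies the factor `α` missing from the `γ² / κ` terms. -/
lemma chain_bound_le {α γ x κ : ℝ} (hα : 2 ≤ α) (hγ : 0 ≤ γ) (hκ : 0 < κ) (hx0 : 0 ≤ x)
    (hx : x ≤ 4 * γ ^ 2 / α ^ 2) :
    α ^ 2 * max (√(x / κ)) (x / κ) + α * (2 * γ) / √κ + (2 * γ) ^ 2 / κ ≤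
      6 * (α * max (γ / √κ) (γ ^ 2 / κ)) := by
  have hα0 : 0 < α := by linarith
  set M := max (γ / √κ) (γ ^ 2 / κ) with hM
  have hM1 : γ / √κ ≤ M := le_max_left _ _
  have hM2 : γ ^ 2 / κ ≤ M := le_max_right _ _
  have hM0 : 0 ≤ M := le_trans (by positivity) hM1
  have h4 : 4 * M ≤ 2 * (α * M) := by nlinarith
  have hxα : α ^ 2 * x ≤ 4 * γ ^ 2 := by
    rw [le_div_iff₀ (by positivity)] at hx; linarith
  have h1 : α ^ 2 * √(x / κ) ≤ 2 * (α * M) := by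
    have : α * √(x / κ) ≤ 2 * (γ / √κ) := by
      rw [Real.sqrt_div hx0, ← mul_div_assoc, ← mul_div_assoc]
      refine div_le_div_of_nonneg_right ?_ (Real.sqrt_nonneg _)
      refine (sq_le_sq₀ (by positivity) (by positivity)).1 ?_
      rw [mul_pow, Real.sq_sqrt hx0]
      linarith
    calc α ^ 2 * √(x / κ) = α * (α * √(x / κ)) := by ring
      _ ≤ α * (2 * M) := mul_le_mul_of_nonneg_left (by linarith) hα0.le
      _ = _ := by ring
  have h2 : α ^ 2 * (x / κ) ≤ 2 * (α * M) := by
    calc α ^ 2 * (x / κ) = α ^ 2 * x / κ := by ring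
      _ ≤ 4 * γ ^ 2 / κ := by gcongr
      _ = 4 * (γ ^ 2 / κ) := by ring
      _ ≤ _ := by linarith
  have h3 : α ^ 2 * max (√(x / κ)) (x / κ) ≤ 2 * (α * M) := by
    rw [mul_max_of_nonneg _ _ (by positivity)]
    exact max_le h1 h2
  have h5 : α * (2 * γ) / √κ ≤ 2 * (α * M) := by
    calc α * (2 * γ) / √κ = 2 * (α * (γ / √κ)) := by ring
      _ ≤ _ := by gcongr
  have h6 : (2 * γ) ^ 2 / κ ≤ 2 * (α * M) := by
    calc (2 * γ) ^ 2 / κ = 4 * (γ ^ 2 / κ) := by ring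
      _ ≤ _ := by linarith
  linarith

/-- The tail bound for the supremum of the empirical process, at every scale `u ≥ 1`. -/
theorem measure_lt_supAbsZ_le (hX : ∀ i, Measurable (X i)) (hind : iIndepFun X P)
    (hlaw : ∀ i, P.map (X i) = μ) (hk : 1 ≤ k) {F : Set (Lp ℝ 2 μ)}
    (hF : F ⊆ Metric.sphere 0 1) (hne : F.Nonempty) (hα : psiTwoDiam μ F ≠ ∞)
    (hγ : gammaTwo (psiTwoDist μ) F ≠ ∞)
    (hαγ : psiTwoDiam μ F ≤ 2 * gammaTwo (psiTwoDist μ) F) {G : Set (Lp ℝ 2 μ)} (hGF : G ⊆ F)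
    (hG : G.Countable) {u : ℝ} (hu : 1 ≤ u) :
    P {ω | ENNReal.ofReal (6000 * u) * chainingBound μ k F < supAbsZ μ X G ω} ≤
      ENNReal.ofReal (Real.exp (-(u * max 1 ((gammaTwo (psiTwoDist μ) F).toReal ^ 2 /
        (psiTwoDiam μ F).toReal ^ 3)))) := by
  rw [ofReal_chainingBound hk hα hγ]
  have hα2 : 2 ≤ (psiTwoDiam μ F).toReal := by
    simpa using ENNReal.toReal_mono hα (two_le_psiTwoDiam hF hne)
  have hαγ' : (psiTwoDiam μ F).toReal ≤ 2 * (gammaTwo (psiTwoDist μ) F).toReal := by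
    simpa using ENNReal.toReal_mono (ENNReal.mul_ne_top ENNReal.ofNat_ne_top hγ) hαγ
  have hFα : ∀ f ∈ F, psiTwoNorm μ f ≤ ENNReal.ofReal ((psiTwoDiam μ F).toReal / 2) := by
    intro f hf
    rw [ENNReal.ofReal_div_of_pos two_pos, ENNReal.ofReal_toReal hα, ENNReal.ofReal_ofNat,
      ENNReal.le_div_iff_mul_le (by simp) (by simp), mul_comm]
    exact mul_le_mul_right (le_iSup₂ (f := fun f (_ : f ∈ F) => psiTwoNorm μ f) f hf) _
  obtain ⟨A, hA, hAΓ⟩ : ∃ A, IsAdmissible F A ∧ ⨆ f ∈ F, ∑' s : ℕ,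
      (2 : ℝ≥0∞) ^ ((s : ℝ) / 2) * ⨅ a ∈ A s, psiTwoDist μ f a ≤
        ENNReal.ofReal (2 * (gammaTwo (psiTwoDist μ) F).toReal) := by
    -- Strict because `2 ≤ α ≤ 2γ` forces `γ > 0`; so some admissible sequence attains `2γ`.
    have h1 : gammaTwo (psiTwoDist μ) F <
        ENNReal.ofReal (2 * (gammaTwo (psiTwoDist μ) F).toReal) :=
      (ENNReal.lt_ofReal_iff_toReal_lt hγ).2 (by linarith)
    conv_lhs at h1 => rw [gammaTwo]
    simp only [iInf_lt_iff] at h1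
    obtain ⟨A, hA, hlt⟩ := h1
    exact ⟨A, hA, hlt.le⟩
  generalize (psiTwoDiam μ F).toReal = α at *
  generalize (gammaTwo (psiTwoDist μ) F).toReal = γ at *
  have hα0 : 0 < α := by linarith
  have hγ0 : 0 ≤ γ := by linarith
  obtain ⟨B, p, hBF, hBc, hpB, hpf, hpΓ⟩ := exists_terminating_chains hA hGF hG (by positivity) hAΓ
  -- `α ≤ 2γ` makes the ratio at least `1`. The upper bound on `2 ^ m` controls the initial term,
  -- the lower one the probability.
  obtain ⟨m, hm1, hm2⟩ := exists_nat_pow_near (x := 4 * γ ^ 2 / α ^ 2) (y := 2)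
    ((one_le_div (by positivity)).2 (by nlinarith)) one_lt_two
  have htail := measure_exists_lt_abs_empiricalZ_le hX hind hlaw hk hF hα2 hFα hBF hBc hpB hpf
    hpΓ m hu
  refine (measure_mono ?_).trans (htail.trans (ENNReal.ofReal_le_ofReal ?_))
  · intro ω hω
    simp only [Set.mem_ofPred_eq, supAbsZ, lt_iSup_iff] at hω
    obtain ⟨f, hf, hlt⟩ := hω
    refine ⟨f, hf, ?_⟩
    rw [← ENNReal.ofReal_mul (by positivity), ENNReal.ofReal_lt_ofReal_iff_of_nonneg
      (by positivity)] at hlt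
    refine lt_of_le_of_lt ?_ hlt
    have := chain_bound_le (κ := k) hα2 hγ0 (by exact_mod_cast hk) (by positivity) hm1
    calc _ ≤ 1000 * u * (6 * (α * max (γ / √k) (γ ^ 2 / k))) := by gcongr
      _ = _ := by ring
  · rw [Real.exp_le_exp, neg_le_neg_iff]
    refine mul_le_mul_of_nonneg_left (max_le (one_le_pow₀ one_le_two) ?_) (by linarith)
    have h1 : 2 * (γ ^ 2 / α ^ 2) < 2 ^ m := by
      rw [pow_succ 2 m, mul_div_assoc] at hm2; linarith
    have h2 : γ ^ 2 / α ^ 3 ≤ γ ^ 2 / α ^ 2 := by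
      gcongr
      · linarith
      · norm_num
    have : 0 ≤ γ ^ 2 / α ^ 2 := by positivity
    linarith

/-- The degenerate cases: for empty `F` the supremum is `0`, otherwise `α ≥ 2` makes the bound
infinite. -/
lemma supAbsZ_le_mul_chainingBound_of_gammaTwo_eq_top {Ω' : Type*} {X : Fin k → Ω' → Ω} {F : Set (Lp ℝ 2 μ)}
    (hF : F ⊆ Metric.sphere 0 1) (hγ : F.Nonempty → gammaTwo (psiTwoDist μ) F = ∞)
    {G : Set (Lp ℝ 2 μ)} (hGF : G ⊆ F) {C : ℝ≥0∞} (hC : C ≠ 0) (ω : Ω') :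
    supAbsZ μ X G ω ≤ C * chainingBound μ k F := by
  rcases F.eq_empty_or_nonempty with rfl | hne
  · rw [Set.subset_empty_iff] at hGF
    simp [supAbsZ, hGF]
  · have h2 : psiTwoDiam μ F ≠ 0 :=
      (lt_of_lt_of_le two_pos (two_le_psiTwoDiam hF hne)).ne'
    have h3 : (k : ℝ≥0∞) ^ (1 / 2 : ℝ) ≠ ∞ :=
      ENNReal.rpow_ne_top_of_nonneg (by norm_num) (ENNReal.natCast_ne_top k)
    rw [chainingBound, hγ hne, ENNReal.top_div_of_ne_top h3, max_eq_left le_top,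
      ENNReal.mul_top h2, ENNReal.mul_top hC]
    exact le_top

end Main

theorem mainTheorem2 :
    ∃ C c : ℝ≥0, 0 < C ∧ 0 < c ∧
      ∀ (Ω : Type*) [MeasurableSpace Ω] (μ : Measure Ω) [IsProbabilityMeasure μ]
        (F : Set (Lp ℝ 2 μ)) (_ : F ⊆ Metric.sphere 0 1) (_ : psiTwoDiam μ F ≠ ∞)
        (k : ℕ) (_ : 1 ≤ k)
        (Ω' : Type*) [MeasurableSpace Ω'] (P : Measure Ω') [IsProbabilityMeasure P]
        (X : Fin k → Ω' → Ω) (_ : ∀ i, Measurable (X i)) (_ : iIndepFun X P)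
        (_ : ∀ i, P.map (X i) = μ),
        (((∀ f ∈ F, -f ∈ F) ∨ psiTwoDiam μ F ≤ 2 * gammaTwo (psiTwoDist μ) F) →
          ∀ G ⊆ F, G.Countable →
            1 - EReal.exp
                (-((c * (gammaTwo (psiTwoDist μ) F ^ 2 / psiTwoDiam μ F ^ 3) : ℝ≥0∞) : EReal)) ≤
              P {ω | supAbsZ μ X G ω ≤ C * chainingBound μ k F}) ∧
        ((∀ f ∈ F, -f ∈ F) →
          ∀ G ⊆ F, G.Countable →
            ∫⁻ ω, supAbsZ μ X G ω ∂P ≤ C * chainingBound μ k F) := by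
  -- The tail bound at `u = 1` needs only `6000`; integrating the tails doubles it.
  refine ⟨12000, 1, by norm_num, one_pos, ?_⟩
  intro Ω _ μ _ F hF hα k hk Ω' _ P _ X hX hind hlaw
  have htop : ((12000 : ℝ≥0) : ℝ≥0∞) ≠ 0 := by norm_num
  by_cases hdeg : F.Nonempty → gammaTwo (psiTwoDist μ) F = ∞
  · refine ⟨fun _ G hGF _ => ?_, fun _ G hGF _ => ?_⟩
    · have huniv : {ω | supAbsZ μ X G ω ≤ (12000 : ℝ≥0) * chainingBound μ k F} = Set.univ :=
        Set.eq_univ_of_forall fun ω =>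
          supAbsZ_le_mul_chainingBound_of_gammaTwo_eq_top hF hdeg hGF htop ω
      rw [huniv, measure_univ]
      exact tsub_le_self
    · refine (lintegral_mono fun ω =>
        supAbsZ_le_mul_chainingBound_of_gammaTwo_eq_top hF hdeg hGF htop ω).trans ?_
      simp
  push Not at hdeg
  obtain ⟨hne, hγ⟩ := hdeg
  have hα2 : psiTwoDiam μ F ≠ 0 := (lt_of_lt_of_le two_pos (two_le_psiTwoDiam hF hne)).ne'
  refine ⟨fun h G hGF hG => ?_, fun hsymm G hGF hG => ?_⟩
  · have hαγ := h.elim psiTwoDiam_le_two_mul_gammaTwo id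
    have htail := measure_lt_supAbsZ_le hX hind hlaw hk hF hne hα hγ hαγ hGF hG le_rfl
    set x := (gammaTwo (psiTwoDist μ) F).toReal ^ 2 / (psiTwoDiam μ F).toReal ^ 3 with hx
    have hx' : ((1 : ℝ≥0) * (gammaTwo (psiTwoDist μ) F ^ 2 / psiTwoDiam μ F ^ 3) : ℝ≥0∞) =
        ENNReal.ofReal x := by
      rw [hx, ← ENNReal.toReal_pow, ← ENNReal.toReal_pow, ← ENNReal.toReal_div,
        ENNReal.ofReal_toReal, ENNReal.coe_one, one_mul]
      exact ENNReal.div_ne_top (ENNReal.pow_ne_top hγ) (pow_ne_zero _ hα2)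
    have hx0 : 0 ≤ x := by positivity
    rw [hx', EReal.coe_ennreal_ofReal, max_eq_left hx0, ← EReal.coe_neg, EReal.exp_coe,
      tsub_le_iff_right, ← measure_univ (μ := P)]
    calc P Set.univ ≤ P ({ω | supAbsZ μ X G ω ≤ (12000 : ℝ≥0) * chainingBound μ k F} ∪
          {ω | ENNReal.ofReal (6000 * 1) * chainingBound μ k F < supAbsZ μ X G ω}) := by
          refine measure_mono fun ω _ => ?_
          rcases le_or_gt (supAbsZ μ X G ω) (ENNReal.ofReal (6000 * 1) * chainingBound μ k F)
            with h | h
          · refine Or.inl (h.trans ?_)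
            gcongr
            norm_num
          · exact Or.inr h
      _ ≤ _ := (measure_union_le _ _).trans (add_le_add le_rfl (htail.trans ?_))
    refine ENNReal.ofReal_le_ofReal (Real.exp_le_exp.2 ?_)
    rw [one_mul, neg_le_neg_iff]
    exact le_max_right _ _
  · have hαγ := psiTwoDiam_le_two_mul_gammaTwo hsymm
    have hγ0 : gammaTwo (psiTwoDist μ) F ≠ 0 := by
      intro h0
      rw [h0, mul_zero, nonpos_iff_eq_zero] at hαγ
      exact hα2 hαγ
    have hB0 : ENNReal.ofReal 6000 * chainingBound μ k F ≠ 0 := by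
      refine mul_ne_zero (by norm_num) (mul_ne_zero hα2 (ne_of_gt ?_))
      refine lt_of_lt_of_le ?_ (le_max_right _ _)
      exact ENNReal.div_pos (pow_ne_zero _ hγ0) (ENNReal.natCast_ne_top k)
    -- Tails at `u = n + 1`: the `max 1` in the exponent gives `exp(-(n + 1)) ≤ 2⁻¹ ^ (n + 1)`,
    -- whatever the size of `γ₂² / α³`.
    refine (lintegral_le_two_mul_of_tail hB0 fun n => ?_).trans_eq ?_
    · have htail := measure_lt_supAbsZ_le hX hind hlaw hk hF hne hα hγ hαγ hGF hG
        (u := n + 1) (by linarith [(Nat.cast_nonneg n : (0 : ℝ) ≤ n)])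
      have e : ENNReal.ofReal (6000 * ((n : ℝ) + 1)) * chainingBound μ k F =
          (n + 1) * (ENNReal.ofReal 6000 * chainingBound μ k F) := by
        rw [ENNReal.ofReal_mul (by norm_num), ENNReal.ofReal_add (by positivity) zero_le_one,
          ENNReal.ofReal_natCast, ENNReal.ofReal_one]
        ring
      rw [e] at htail
      refine htail.trans ?_
      have h4 : (2⁻¹ : ℝ≥0∞) ^ (n + 1) = ENNReal.ofReal (2⁻¹ ^ (n + 1)) := by
        rw [ENNReal.ofReal_pow (by positivity), ENNReal.ofReal_inv_of_pos two_pos]; simp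
      have h2 : (2 : ℝ) ≤ Real.exp 1 := by
        have := Real.add_one_le_exp 1
        linarith
      rw [h4]
      refine ENNReal.ofReal_le_ofReal ?_
      calc _ ≤ Real.exp (((n + 1 : ℕ) : ℝ) * (-1)) := by
            rw [Real.exp_le_exp]
            push_cast
            rw [mul_neg, neg_le_neg_iff]
            gcongr
            exact le_max_left _ _
        _ = (Real.exp 1)⁻¹ ^ (n + 1) := by rw [Real.exp_nat_mul, Real.exp_neg 1]
        _ ≤ _ := by gcongr
    · rw [← mul_assoc]
      congr 1
      rw [← ENNReal.ofReal_coe_nnreal, ← ENNReal.ofReal_ofNat 2, ← ENNReal.ofReal_mul zero_le_two]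
      norm_num
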